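/- Let $p\ge 2$, let $\|\cdot\|$ be the Euclidean norm on $\mathbb{R}^p$, and let $s(x)=x/\|x\|$ for $x\neq 0$, $s(0)=0$. For a probability distribution $F$ on $\mathbb{R}^p$ and $X\sim F$ let $\mu=\mu(F)$ be the spatial median, i.e. the minimizer of $m\mapsto E(\|X-m\|-\|X\|)$ (the barycenter of the set of minimizers if there are several), and let $S(F)=E\{s(X-\mu)s(X-\mu)^T\}$ be the spatial sign covariance matrix. For $x_1,\dots,x_n,t\in\mathbb{R}^p$ let $\hat S_n(x_1,\dots,x_n;t)=\frac1n\sum_{i=1}^n s(x_i-t)s(x_i-t)^T$. Let $X_1,X_2,\dots$ be i.i.d. with distribution $F$ such that $E\|X-\mu\|^{-1}<\infty$, and let $(T_n)$ be a sequence of $\mathbb{R}^p$-valued random variables, on the same probability space, converging almost surely to $\mu$. Write $\hat S_n=\hat S_n(X_1,\dots,X_n;T_n)$. Then, as $n\to\infty$: (1) $\hat S_n\to S(F)$ almost surely. (2) If furthermore $\sqrt n\,\|T_n-\mu\|$ converges in distribution, $E\|X-\mu\|^{-3/2}<\infty$, and $X-\mu$ and $-(X-\mu)$ have the same distribution, then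 there is a symmetric non-negative definite $p^2\times p^2$ matrix $W_S$ with $$\sqrt n\,\operatorname{vec}\{\hat S_n-S(F)\}\xrightarrow{d}N_{p^2}(0,W_S),$$ where $\operatorname{vec}$ stacks the columns of a matrix from left to right underneath each other. (3) If, in addition to all assumptions of (2), $p=2$ and $F$ is elliptical, i.e. has a Lebesgue density $f(x)=\det(V)^{-1/2}g\big((x-m)^TV^{-1}(x-m)\big)$ with some $m\in\mathbb{R}^2$, some symmetric positive definite $V$ and some measurable $g\ge 0$, and if $V=U\operatorname{diag}(\lambda_1,\lambda_2)U^T$ with $U$ orthogonal and $0<\lambda_2\le\lambda_1$, then $$W_S=\frac{-\lambda_1\lambda_2+\frac12\sqrt{\lambda_1\lambda_2}\,(\lambda_1+\lambda_2)}{(\lambda_1-\lambda_2)^2}\,(U\otimes U)W_0(U\otimes U)^T,\qquad W_0=\begin{pmatrix}1&0&0&-1\\0&1&1&0\\0&1&1&0\\-1&0&0&1\end{pmatrix},$$ where for $\lambda_1=\lambda_2$ the fraction is read as its limit $1/8$. -/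

import Mathlib

open MeasureTheory ProbabilityTheory Filter Topology
open scoped Matrix Kronecker ENNReal

noncomputable section

namespace SSCM

/-- The spatial sign `s(x) = x / ‖x‖`; since `0⁻¹ = 0` this gives `s(0) = 0`. -/
def spatialSign {p : ℕ} (x : EuclideanSpace ℝ (Fin p)) : EuclideanSpace ℝ (Fin p) :=
  ‖x‖⁻¹ • x

/-- The rank-one matrix `s(x) s(x)ᵀ`. -/
def signOuter {p : ℕ} (x : EuclideanSpace ℝ (Fin p)) : Matrix (Fin p) (Fin p) ℝ :=
  Matrix.vecMulVec (spatialSign x).ofLp (spatialSign x).ofLp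

/-- The set of minimizers of `m ↦ E(‖X - m‖ - ‖X‖)`, where `X` has distribution `F`. -/
def medianSet {p : ℕ} (F : Measure (EuclideanSpace ℝ (Fin p))) :
    Set (EuclideanSpace ℝ (Fin p)) :=
  {m | ∀ m', ∫ x, (‖x - m‖ - ‖x‖) ∂F ≤ ∫ x, (‖x - m'‖ - ‖x‖) ∂F}

/-- The barycenter of a convex set `C`: the mean of the uniform distribution on `C`, i.e. of the
normalized Hausdorff measure whose dimension is the affine dimension of `C`. For a one-point set
this is the point, for a segment its midpoint. -/
def barycenter {p : ℕ} (C : Set (EuclideanSpace ℝ (Fin p))) : EuclideanSpace ℝ (Fin p) :=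
  ⨍ x in C, x ∂(μH[(Module.finrank ℝ (vectorSpan ℝ C) : ℝ)])

/-- The spatial median `μ(F)`: the minimizer of `m ↦ E(‖X - m‖ - ‖X‖)`, and the barycenter of
the set of minimizers if there are several. -/
def spatialMedian {p : ℕ} (F : Measure (EuclideanSpace ℝ (Fin p))) : EuclideanSpace ℝ (Fin p) :=
  barycenter (medianSet F)

/-- The spatial sign covariance matrix `S(F) = E(s(X - μ(F)) s(X - μ(F))ᵀ)`, entry by entry. -/
def sscm {p : ℕ} (F : Measure (EuclideanSpace ℝ (Fin p))) : Matrix (Fin p) (Fin p) ℝ :=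
  Matrix.of fun i j => ∫ x, signOuter (x - spatialMedian F) i j ∂F

/-- The empirical spatial sign covariance matrix of the sample `x` of size `n` with respect to
the location `t`. -/
def empiricalSSCM {p n : ℕ} (x : Fin n → EuclideanSpace ℝ (Fin p))
    (t : EuclideanSpace ℝ (Fin p)) : Matrix (Fin p) (Fin p) ℝ :=
  (n : ℝ)⁻¹ • ∑ i, signOuter (x i - t)

/-- The column-stacking operator `vec`, with values in a Euclidean space; the coordinate `(j, i)`
of `vecE A` is `A i j`. -/
def vecE {p : ℕ} (A : Matrix (Fin p) (Fin p) ℝ) : EuclideanSpace ℝ (Fin p × Fin p) :=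
  WithLp.toLp 2 (Matrix.vec A)

/-- `F` is a continuous elliptical distribution with symmetry center `m` and shape matrix `V`:
it has the Lebesgue density `det(V)^(-1/2) g((x - m)ᵀ V⁻¹ (x - m))`. -/
def IsElliptical {p : ℕ} (F : Measure (EuclideanSpace ℝ (Fin p)))
    (m : EuclideanSpace ℝ (Fin p)) (V : Matrix (Fin p) (Fin p) ℝ) : Prop :=
  V.PosDef ∧ ∃ g : ℝ → ℝ, Measurable g ∧ (∀ t, 0 ≤ g t) ∧
    F = volume.withDensity fun x => ENNReal.ofReal
      ((√V.det)⁻¹ * g ((x - m).ofLp ⬝ᵥ (V⁻¹ *ᵥ (x - m).ofLp)))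

/-- The matrix `W₀`. -/
def W₀ : Matrix (Fin 4) (Fin 4) ℝ :=
  !![1, 0, 0, -1;
     0, 1, 1, 0;
     0, 1, 1, 0;
     -1, 0, 0, 1]

/-- The scalar factor of the asymptotic covariance matrix. On the diagonal `a = b`, where the
quotient has the form `0 / 0`, it stands for its continuous extension, which is `1 / 8`. -/
def covFactor (a b : ℝ) : ℝ :=
  if a = b then 1 / 8 else (-(a * b) + 1 / 2 * √(a * b) * (a + b)) / (a - b) ^ 2

/-- Position `2 j + i` in `vec A` of the entry `A i j` of a 2 × 2 matrix `A`. -/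
def vecIndex {p : ℕ} (hp : p = 2) (q : Fin p × Fin p) : Fin 4 :=
  finProdFinEquiv (Fin.cast hp q.1, Fin.cast hp q.2)

end SSCM

end

/-! Write `c` for the spatial median, `y = x - c`, `u = T n - c`. Only the integrability of `‖y‖⁻¹`
and, later, symmetry about `c` matter; the minimizing property is never used.

Consistency: shifting `y` by `u` changes each entry of `signOuter` by at most `6 ‖u‖ / ‖y‖`
(`abs_signOuter_sub_le`). The strong law keeps the average of `‖y‖⁻¹` bounded, so the estimated
location may be replaced by `c`, and the strong law applies once more.

Normality: a first-order expansion has remainder `14 (‖u‖ / ‖y‖) ^ (3 / 2)`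
(`abs_signOuter_sub_sub_deriv_le`). Its linear coefficients are odd in `y`, so under symmetry their
averages tend to `0` almost surely. After scaling by `√n`, both terms are the convergent factor `√n
‖u‖` times something vanishing, and Slutsky leaves the central limit theorem for bounded summands
with known location. The limiting covariance is `signCov F c`.

Planar elliptical case: two centers of symmetry of a probability measure coincide (`center_unique`),
so `c = m`. In the eigenbasis, `signOuter` is affine in the squared direction `ζ = z / conj z`, a
point of the unit circle, so the covariance needs only the means of `ζ` and `ζ ^ 2`. Polar
coordinates reduce these to averages over an ellipse, and the mean value property evaluates them as
`κ` and `κ ^ 2`, where `κ = (√λ₁ - √λ₂) / (√λ₁ + √λ₂)`. -/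

noncomputable section

namespace SSCM

/-! ### Expansion of the sign outer product under a shift -/

section SignOuter

variable {p : ℕ}

lemma signOuter_apply (y : EuclideanSpace ℝ (Fin p)) (i j : Fin p) :
    signOuter y i j = y i * y j / ‖y‖ ^ 2 := by
  simp only [signOuter, spatialSign, Matrix.vecMulVec_apply, PiLp.smul_apply, smul_eq_mul]
  ring

lemma abs_apply_le_norm (y : EuclideanSpace ℝ (Fin p)) (i : Fin p) : |y i| ≤ ‖y‖ := by
  simpa using PiLp.norm_apply_le y i

lemma abs_apply_mul_apply_le (x y : EuclideanSpace ℝ (Fin p)) (i j : Fin p) :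
    |x i * y j| ≤ ‖x‖ * ‖y‖ := by
  rw [abs_mul]
  exact mul_le_mul (abs_apply_le_norm x i) (abs_apply_le_norm y j) (abs_nonneg _) (norm_nonneg _)

lemma abs_signOuter_le_one (y : EuclideanSpace ℝ (Fin p)) (i j : Fin p) :
    |signOuter y i j| ≤ 1 := by
  rw [signOuter_apply, abs_div, abs_of_nonneg (sq_nonneg ‖y‖), sq]
  exact div_le_one_of_le₀ (abs_apply_mul_apply_le y y i j) (by positivity)

lemma signOuter_mul_sq_norm (y : EuclideanSpace ℝ (Fin p)) (i j : Fin p) :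
    signOuter y i j * ‖y‖ ^ 2 = y i * y j := by
  rcases eq_or_ne y 0 with rfl | hy
  · simp
  · rw [signOuter_apply, div_mul_cancel₀]
    simpa using hy

@[fun_prop]
lemma measurable_signOuter_apply (i j : Fin p) :
    Measurable fun y : EuclideanSpace ℝ (Fin p) => signOuter y i j := by
  simp_rw [signOuter_apply]
  fun_prop

lemma signOuter_neg (y : EuclideanSpace ℝ (Fin p)) : signOuter (-y) = signOuter y := by
  ext i j
  simp [signOuter_apply]

/-- The coefficients of the derivative of `u ↦ s(y - u) s(y - u)ᵀ` at `u = 0`. -/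
def signOuterDeriv (i j k : Fin p) (y : EuclideanSpace ℝ (Fin p)) : ℝ :=
  (2 * signOuter y i j * y k - (if j = k then y i else 0) - (if i = k then y j else 0)) / ‖y‖ ^ 2

/-- This oddness makes the linear term of the expansion average out under a symmetric law. -/
lemma signOuterDeriv_neg (i j k : Fin p) (y : EuclideanSpace ℝ (Fin p)) :
    signOuterDeriv i j k (-y) = -signOuterDeriv i j k y := by
  simp only [signOuterDeriv, signOuter_neg, norm_neg, PiLp.neg_apply]
  split_ifs <;> ring

@[fun_prop]
lemma measurable_signOuterDeriv (i j k : Fin p) : Measurable (signOuterDeriv i j k) := by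
  unfold signOuterDeriv
  split_ifs <;> fun_prop

lemma abs_signOuterDeriv_le (i j k : Fin p) (y : EuclideanSpace ℝ (Fin p)) :
    |signOuterDeriv i j k y| ≤ 4 * ‖y‖⁻¹ := by
  rcases eq_or_ne y 0 with rfl | hy
  · simp [signOuterDeriv]
  have hN : 0 < ‖y‖ := norm_pos_iff.2 hy
  have h1 : |2 * signOuter y i j * y k| ≤ 2 * ‖y‖ := by
    rw [abs_mul, abs_mul, abs_two]
    nlinarith [abs_signOuter_le_one y i j, abs_apply_le_norm y k, abs_nonneg (y k)]
  have h2 : |if j = k then y i else 0| ≤ ‖y‖ := by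
    split_ifs
    · exact abs_apply_le_norm y i
    · simp
  have h3 : |if i = k then y j else 0| ≤ ‖y‖ := by
    split_ifs
    · exact abs_apply_le_norm y j
    · simp
  rw [signOuterDeriv, abs_div, abs_of_nonneg (sq_nonneg ‖y‖), div_le_iff₀ (by positivity)]
  have h4 : 4 * ‖y‖⁻¹ * ‖y‖ ^ 2 = 4 * ‖y‖ := by field_simp
  rw [h4]
  have := abs_sub (2 * signOuter y i j * y k - if j = k then y i else 0) (if i = k then y j else 0)
  have := abs_sub (2 * signOuter y i j * y k) (if j = k then y i else 0)
  linarith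

lemma sum_signOuterDeriv_mul (i j : Fin p) (y u : EuclideanSpace ℝ (Fin p)) :
    ∑ k, signOuterDeriv i j k y * u k =
      (2 * signOuter y i j * inner ℝ y u - (y i * u j + u i * y j)) / ‖y‖ ^ 2 := by
  have hin : inner ℝ y u = ∑ k, y k * u k := by
    simp [PiLp.inner_apply, mul_comm]
  have h1 : ∀ k, signOuterDeriv i j k y * u k = (2 * signOuter y i j * (y k * u k)
      - (if j = k then y i * u k else 0) - (if i = k then y j * u k else 0)) / ‖y‖ ^ 2 := by
    intro k
    unfold signOuterDeriv
    split_ifs <;> ring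
  simp_rw [h1]
  rw [← Finset.sum_div, Finset.sum_sub_distrib, Finset.sum_sub_distrib, ← Finset.mul_sum, hin]
  simp
  ring

/-- The exact increment of the sign outer product. -/
lemma signOuter_sub_sub_mul (i j : Fin p) (y u : EuclideanSpace ℝ (Fin p)) :
    (signOuter (y - u) i j - signOuter y i j) * ‖y‖ ^ 2 =
      2 * signOuter (y - u) i j * inner ℝ y u - signOuter (y - u) i j * ‖u‖ ^ 2
        - (y i * u j + u i * y j) + u i * u j := by
  have h1 := signOuter_mul_sq_norm (y - u) i j
  rw [@norm_sub_sq_real] at h1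
  simp only [PiLp.sub_apply] at h1
  linear_combination h1 - signOuter_mul_sq_norm y i j

/-- If `‖u‖ ≤ ‖y‖`, the terms of the exact increment contribute 2 + 1 + 1 + 1 + 1 multiples of `‖y‖
‖u‖`. Otherwise the right side is at least 6, while the left is at most 2. -/
lemma abs_signOuter_sub_le {y : EuclideanSpace ℝ (Fin p)} (hy : y ≠ 0)
    (u : EuclideanSpace ℝ (Fin p)) (i j : Fin p) :
    |signOuter (y - u) i j - signOuter y i j| ≤ 6 * (‖u‖ * ‖y‖⁻¹) := by
  have hN : 0 < ‖y‖ := norm_pos_iff.2 hy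
  have hu : 0 ≤ ‖u‖ := norm_nonneg u
  have hs := abs_signOuter_le_one (y - u) i j
  rcases le_total ‖u‖ ‖y‖ with h | h
  · have h1 : |2 * signOuter (y - u) i j * inner ℝ y u| ≤ 2 * (‖y‖ * ‖u‖) := by
      rw [abs_mul, abs_mul, abs_two]
      nlinarith [abs_real_inner_le_norm y u, abs_nonneg (inner ℝ y u)]
    have h2 : |signOuter (y - u) i j * ‖u‖ ^ 2| ≤ ‖y‖ * ‖u‖ := by
      rw [abs_mul, abs_of_nonneg (sq_nonneg ‖u‖)]
      nlinarith
    have h3 := abs_apply_mul_apply_le y u i j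
    have h4 := abs_apply_mul_apply_le u y i j
    have h5 : |u i * u j| ≤ ‖y‖ * ‖u‖ := by nlinarith [abs_apply_mul_apply_le u u i j]
    have h6 : |(signOuter (y - u) i j - signOuter y i j) * ‖y‖ ^ 2| ≤ 6 * (‖y‖ * ‖u‖) := by
      rw [signOuter_sub_sub_mul]
      rw [abs_le] at *
      constructor <;> linarith
    rw [abs_mul, abs_of_nonneg (sq_nonneg ‖y‖)] at h6
    have h7 : 6 * (‖u‖ * ‖y‖⁻¹) = 6 * (‖y‖ * ‖u‖) / ‖y‖ ^ 2 := by field_simp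
    rw [h7, le_div_iff₀ (by positivity)]
    exact h6
  · have h1 : 1 ≤ ‖u‖ * ‖y‖⁻¹ := by
      rw [← div_eq_mul_inv, one_le_div hN]
      exact h
    have := abs_sub (signOuter (y - u) i j) (signOuter y i j)
    linarith [abs_signOuter_le_one y i j]

/-- With `r = ‖u‖ / ‖y‖`, the error is at most `14 r ^ 2` for `r ≤ 1` and at most `6 r + 4 r` for `r
≥ 1`. The power `3 / 2` dominates both regimes, so a moment of order `-3/2` suffices where a plain
Taylor bound would need order `-2`. -/
lemma abs_signOuter_sub_sub_deriv_le {y : EuclideanSpace ℝ (Fin p)} (hy : y ≠ 0)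
    (u : EuclideanSpace ℝ (Fin p)) (i j : Fin p) :
    |signOuter (y - u) i j - signOuter y i j - ∑ k, signOuterDeriv i j k y * u k| ≤
      14 * (‖u‖ ^ (3 / 2 : ℝ) * ‖y‖ ^ (-(3 / 2) : ℝ)) := by
  have hN : 0 < ‖y‖ := norm_pos_iff.2 hy
  have hu : 0 ≤ ‖u‖ := norm_nonneg u
  set r := ‖u‖ * ‖y‖⁻¹ with hr
  have hr0 : 0 ≤ r := by positivity
  have hur : ‖u‖ = r * ‖y‖ := by rw [hr]; field_simp
  have hrpow : ‖u‖ ^ (3 / 2 : ℝ) * ‖y‖ ^ (-(3 / 2) : ℝ) = r ^ (3 / 2 : ℝ) := by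
    rw [hr, Real.mul_rpow hu (by positivity), Real.rpow_neg hN.le, Real.inv_rpow hN.le]
  rw [hrpow]
  have hfirst := abs_signOuter_sub_le hy u i j
  have hin := abs_real_inner_le_norm y u
  have hcr1 := abs_apply_mul_apply_le y u i j
  have hcr2 := abs_apply_mul_apply_le u y i j
  rcases le_total r 1 with h | h
  · have hpow : r ^ 2 ≤ r ^ (3 / 2 : ℝ) := by
      rw [← Real.rpow_natCast]
      exact Real.rpow_le_rpow_of_exponent_ge_of_imp hr0 h (by norm_num) (by norm_num)
    refine le_trans ?_ (mul_le_mul_of_nonneg_left hpow (by norm_num))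
    -- Subtracting the linear part turns the factor of the inner product into an increment, which is
    -- itself of order `r`; every remaining term is then quadratic.
    have key : (signOuter (y - u) i j - signOuter y i j - ∑ k, signOuterDeriv i j k y * u k)
        * ‖y‖ ^ 2 = 2 * (signOuter (y - u) i j - signOuter y i j) * inner ℝ y u
          - signOuter (y - u) i j * ‖u‖ ^ 2 + u i * u j := by
      rw [sub_mul, signOuter_sub_sub_mul, sum_signOuterDeriv_mul,
        div_mul_cancel₀ _ (by positivity)]
      ring
    have h1 : |2 * (signOuter (y - u) i j - signOuter y i j) * inner ℝ y u|
        ≤ 12 * (r * r * ‖y‖ ^ 2) := by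
      rw [abs_mul, abs_mul, abs_two]
      calc 2 * |signOuter (y - u) i j - signOuter y i j| * |inner ℝ y u|
          ≤ 2 * (6 * r) * (‖y‖ * ‖u‖) := by gcongr
        _ = 12 * (r * r * ‖y‖ ^ 2) := by rw [hur]; ring
    have h2 : |signOuter (y - u) i j * ‖u‖ ^ 2| ≤ r * r * ‖y‖ ^ 2 := by
      rw [abs_mul, abs_of_nonneg (sq_nonneg ‖u‖)]
      calc _ ≤ 1 * ‖u‖ ^ 2 := by gcongr; exact abs_signOuter_le_one _ _ _
        _ = r * r * ‖y‖ ^ 2 := by rw [hur]; ring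
    have h3 : |u i * u j| ≤ r * r * ‖y‖ ^ 2 := by
      calc _ ≤ ‖u‖ * ‖u‖ := abs_apply_mul_apply_le u u i j
        _ = r * r * ‖y‖ ^ 2 := by rw [hur]; ring
    have h4 : |(signOuter (y - u) i j - signOuter y i j - ∑ k, signOuterDeriv i j k y * u k)
        * ‖y‖ ^ 2| ≤ 14 * (r * r * ‖y‖ ^ 2) := by
      rw [key]
      rw [abs_le] at *
      constructor <;> linarith
    rw [abs_mul, abs_of_nonneg (sq_nonneg ‖y‖)] at h4
    refine le_of_mul_le_mul_right (h4.trans_eq ?_) (by positivity : 0 < ‖y‖ ^ 2)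
    ring
  · have hpow : r ≤ r ^ (3 / 2 : ℝ) := by
      conv_lhs => rw [← Real.rpow_one r]
      exact Real.rpow_le_rpow_of_exponent_le h (by norm_num)
    have hder : |∑ k, signOuterDeriv i j k y * u k| ≤ 4 * r := by
      rw [sum_signOuterDeriv_mul, abs_div, abs_of_nonneg (sq_nonneg ‖y‖),
        div_le_iff₀ (by positivity)]
      have h1 : |2 * signOuter y i j * inner ℝ y u| ≤ 2 * (‖y‖ * ‖u‖) := by
        rw [abs_mul, abs_mul, abs_two]
        calc _ ≤ 2 * 1 * (‖y‖ * ‖u‖) := by gcongr; exact abs_signOuter_le_one _ _ _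
          _ = _ := by ring
      have h2 : 4 * r * ‖y‖ ^ 2 = 4 * (‖y‖ * ‖u‖) := by rw [hur]; ring
      rw [h2]
      rw [abs_le] at *
      constructor <;> linarith
    have := abs_sub (signOuter (y - u) i j - signOuter y i j) (∑ k, signOuterDeriv i j k y * u k)
    linarith

end SignOuter

/-! ### Strong law and Slutsky-type tools -/

section General

variable {Ω : Type*} [MeasurableSpace Ω] {P : Measure Ω}

/-- Strong law of large numbers for functions of an i.i.d. sequence. -/
lemma tendsto_average_ae {E : Type*} [MeasurableSpace E] {F : Measure E}
    {X : ℕ → Ω → E} (hX : ∀ i, HasLaw (X i) F P) (hindep : iIndepFun X P)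
    {f : E → ℝ} (hf : Measurable f) (hint : Integrable f F) :
    ∀ᵐ ω ∂P, Tendsto (fun n : ℕ => (n : ℝ)⁻¹ * ∑ k ∈ Finset.range n, f (X k ω)) atTop
      (𝓝 (∫ x, f x ∂F)) := by
  have hid : ∀ i, IdentDistrib (fun ω => f (X i ω)) (fun ω => f (X 0 ω)) P P := fun i =>
    IdentDistrib.comp ⟨(hX i).aemeasurable, (hX 0).aemeasurable,
      by rw [(hX i).map_eq, (hX 0).map_eq]⟩ hf
  have hint0 : Integrable (fun ω => f (X 0 ω)) P := by
    have : Integrable f (P.map (X 0)) := by rwa [(hX 0).map_eq]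
    exact this.comp_aemeasurable (hX 0).aemeasurable
  have h := strong_law_ae_real (fun i ω => f (X i ω)) hint0
    (fun i j hij => (hindep.indepFun hij).comp hf hf) hid
  have hE : ∫ ω, f (X 0 ω) ∂P = ∫ x, f x ∂F := (hX 0).integral_comp hf.aestronglyMeasurable
  filter_upwards [h] with ω hω
  rw [hE] at hω
  refine hω.congr fun n => ?_
  rw [div_eq_inv_mul]

variable [IsProbabilityMeasure P]

/-- Convergence in distribution to a constant implies convergence in probability. -/
lemma tendstoInMeasure_of_tendstoInDistribution_zero {Ω' : Type*} [MeasurableSpace Ω']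
    {P' : Measure Ω'} [IsProbabilityMeasure P'] {V : ℕ → Ω → ℝ}
    (h : TendstoInDistribution V atTop (fun _ : Ω' => (0 : ℝ)) (fun _ => P) P') :
    TendstoInMeasure P V atTop 0 := by
  rw [tendstoInMeasure_iff_norm]
  intro ε hε
  have hcl : IsClosed {x : ℝ | ε ≤ ‖x‖} := isClosed_le continuous_const continuous_norm
  have hlim := ProbabilityMeasure.limsup_measure_closed_le_of_tendsto h.tendsto hcl
  have h0 : (P'.map fun _ => (0 : ℝ)) {x : ℝ | ε ≤ ‖x‖} = 0 := by
    rw [Measure.map_apply measurable_const hcl.measurableSet]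
    simp [hε.not_ge]
  have heq : ∀ n, (P.map (V n)) {x : ℝ | ε ≤ ‖x‖} = P {ω | ε ≤ ‖V n ω - (0 : Ω → ℝ) ω‖} := by
    intro n
    rw [Measure.map_apply_of_aemeasurable (h.forall_aemeasurable n) hcl.measurableSet]
    simp
  simp only [ProbabilityMeasure.coe_mk, h0, heq] at hlim
  exact tendsto_of_le_liminf_of_limsup_le zero_le hlim

/-- If `Z n` converges in distribution, `A n` converges to `0` almost surely and
`‖V n‖ ≤ Z n * A n` almost surely, then `V n` converges to `0` in probability. -/
lemma tendstoInMeasure_zero_of_norm_le_mul {E : Type*} [NormedAddCommGroup E]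
    {V : ℕ → Ω → E} {Z A : ℕ → Ω → ℝ} {Ω' : Type*} [MeasurableSpace Ω'] {P' : Measure Ω'}
    [IsProbabilityMeasure P'] {Z' : Ω' → ℝ}
    (hZ : TendstoInDistribution Z atTop Z' (fun _ => P) P')
    (hA : ∀ n, AEMeasurable (A n) P)
    (hA0 : ∀ᵐ ω ∂P, Tendsto (fun n => A n ω) atTop (𝓝 0))
    (hV : ∀ n, ∀ᵐ ω ∂P, ‖V n ω‖ ≤ Z n ω * A n ω) :
    TendstoInMeasure P V atTop 0 := by
  have hAm : TendstoInMeasure P A atTop (fun _ => (0 : ℝ)) :=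
    tendstoInMeasure_of_tendsto_ae (fun n => (hA n).aestronglyMeasurable) hA0
  have hprod := hZ.continuous_comp_prodMk_of_tendstoInMeasure_const
    (g := fun x : ℝ × ℝ => x.1 * x.2) (by fun_prop) hAm hA
  simp only [mul_zero] at hprod
  have hm := tendstoInMeasure_of_tendstoInDistribution_zero hprod
  rw [tendstoInMeasure_iff_norm] at hm ⊢
  intro ε hε
  refine tendsto_of_tendsto_of_tendsto_of_le_of_le tendsto_const_nhds (hm ε hε)
    (fun _ => zero_le) fun n => measure_mono_ae ?_
  filter_upwards [hV n] with ω hω hle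
  simp only [Pi.zero_apply, sub_zero] at hle ⊢
  exact hle.trans (hω.trans (le_abs_self _))

end General

/-! ### Multivariate central limit theorem -/

section CLT

variable {Ω : Type*} [MeasurableSpace Ω] {P : Measure Ω} {ι : Type*} [Fintype ι]

/-- The covariance matrix of a random vector. -/
def covMatrix (P : Measure Ω) (Z : Ω → EuclideanSpace ℝ ι) : Matrix ι ι ℝ :=
  Matrix.of fun i j => cov[fun ω => Z ω i, fun ω => Z ω j; P]

lemma memLp_apply {Z : Ω → EuclideanSpace ℝ ι} (hZ : MemLp Z 2 P) (i : ι) :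
    MemLp (fun ω => Z ω i) 2 P :=
  (EuclideanSpace.proj (𝕜 := ℝ) (ι := ι) i : EuclideanSpace ℝ ι →L[ℝ] ℝ).comp_memLp' hZ

variable [IsProbabilityMeasure P]

/-- This identity yields both the semidefiniteness of the covariance matrix and the exponent of the
Gaussian characteristic function. -/
lemma variance_inner_eq {Z : Ω → EuclideanSpace ℝ ι} (hZ : MemLp Z 2 P)
    (t : EuclideanSpace ℝ ι) :
    Var[fun ω => inner ℝ (Z ω) t; P] = t.ofLp ⬝ᵥ covMatrix P Z *ᵥ t.ofLp := by
  have hin : (fun ω => inner ℝ (Z ω) t) = fun ω => ∑ i, t i * Z ω i := by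
    ext ω
    simp [PiLp.inner_apply]
  have hm : ∀ i, MemLp (fun ω => t i * Z ω i) 2 P := fun i => (memLp_apply hZ i).const_mul _
  rw [hin, variance_fun_sum hm]
  simp only [dotProduct, Matrix.mulVec, covMatrix, Matrix.of_apply, Finset.mul_sum]
  refine Finset.sum_congr rfl fun i _ => Finset.sum_congr rfl fun j _ => ?_
  rw [covariance_const_mul_left, covariance_const_mul_right]
  ring

lemma posSemidef_covMatrix {Z : Ω → EuclideanSpace ℝ ι} (hZ : MemLp Z 2 P) :
    (covMatrix P Z).PosSemidef := by
  refine Matrix.PosSemidef.of_dotProduct_mulVec_nonneg ?_ fun x => ?_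
  · ext i j
    simp [covMatrix, covariance_comm]
  · have := variance_inner_eq hZ (WithLp.toLp 2 x)
    simp only [star_trivial]
    rw [← this]
    exact variance_nonneg _ _

/-- The multivariate central limit theorem. -/
theorem tendstoInDistribution_multivariate [DecidableEq ι] {Z : ℕ → Ω → EuclideanSpace ℝ ι}
    (hZ : MemLp (Z 0) 2 P) (hindep : iIndepFun Z P)
    (hident : ∀ i, IdentDistrib (Z i) (Z 0) P P) :
    TendstoInDistribution
      (fun (n : ℕ) ω => (√(n : ℝ))⁻¹ • (∑ k ∈ Finset.range n, Z k ω - (n : ℝ) • P[Z 0]))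
      atTop id (fun _ => P) (multivariateGaussian 0 (covMatrix P (Z 0))) := by
  have hmeas : ∀ n : ℕ, AEMeasurable
      (fun ω => (√(n : ℝ))⁻¹ • (∑ k ∈ Finset.range n, Z k ω - (n : ℝ) • P[Z 0])) P := fun n =>
    AEMeasurable.fun_const_smul ((Finset.aemeasurable_fun_sum _ fun i _ =>
      (hident i).aemeasurable_fst).sub_const _) _
  refine ⟨hmeas, aemeasurable_id, ?_⟩
  refine ProbabilityMeasure.tendsto_iff_tendsto_charFun.2 fun t => ?_
  have hin : Measurable fun z : EuclideanSpace ℝ ι => (inner ℝ z t : ℝ) := by fun_prop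
  have hint : Integrable (Z 0) P := hZ.integrable (by norm_num)
  have hclt := tendstoInDistribution_inv_sqrt_mul_sum_sub (P := P)
    (X := fun i ω => inner ℝ (Z i ω) t)
    (Y := (id : ℝ → ℝ)) (P' := gaussianReal 0 Var[fun ω => inner ℝ (Z 0 ω) t; P].toNNReal)
    HasLaw.id (hZ.inner_const t) (hindep.comp (fun _ z => inner ℝ z t) fun _ => hin)
    (fun i => (hident i).comp hin)
  -- Cramér–Wold: the characteristic function of a vector at `t` is that of its projection on `t`,
  -- evaluated at 1.
  have hch := (ProbabilityMeasure.tendsto_iff_tendsto_charFun.1 hclt.tendsto) 1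
  simp only [ProbabilityMeasure.coe_mk, Measure.map_id] at hch ⊢
  rw [charFun_multivariateGaussian (posSemidef_covMatrix hZ), ← variance_inner_eq hZ]
  rw [charFun_gaussianReal] at hch
  convert hch using 2
  · rename_i n
    rw [charFun_apply, charFun_apply_real, integral_map (hmeas n) (by fun_prop),
      integral_map (hclt.forall_aemeasurable n) (by fun_prop)]
    refine integral_congr_ae (ae_of_all _ fun ω => ?_)
    have : inner ℝ (∫ ω, Z 0 ω ∂P) t = ∫ ω, inner ℝ (Z 0 ω) t ∂P := by
      simp_rw [real_inner_comm t]
      exact (integral_inner hint t).symm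
    simp [inner_smul_left, inner_sub_left, sum_inner, this]
  · simp [variance_nonneg]

end CLT

/-! ### Consistency and asymptotic normality -/

section Asymptotics

variable {p : ℕ}

lemma empiricalSSCM_apply {Ω : Type*} (X : ℕ → Ω → EuclideanSpace ℝ (Fin p)) (n : ℕ) (ω : Ω)
    (t : EuclideanSpace ℝ (Fin p)) (i j : Fin p) :
    empiricalSSCM (fun k : Fin n => X k ω) t i j =
      (n : ℝ)⁻¹ * ∑ k ∈ Finset.range n, signOuter (X k ω - t) i j := by
  rw [empiricalSSCM, Matrix.smul_apply, Matrix.sum_apply, smul_eq_mul,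
    Fin.sum_univ_eq_sum_range (fun k => signOuter (X k ω - t) i j)]

variable {F : Measure (EuclideanSpace ℝ (Fin p))} {c : EuclideanSpace ℝ (Fin p)}

/-- In `ℝ≥0∞` the inverse of zero is `∞`, so a finite integral excludes an atom at `c`. The real
inverse, which is 0 there, would not see it. -/
lemma ae_sub_ne_zero (hF : ∫⁻ x, ‖x - c‖ₑ⁻¹ ∂F < ∞) : ∀ᵐ x ∂F, x - c ≠ 0 := by
  filter_upwards [ae_lt_top (by fun_prop) hF.ne] with x hx h0
  simp [h0] at hx

lemma integrable_inv_norm_sub (hF : ∫⁻ x, ‖x - c‖ₑ⁻¹ ∂F < ∞) :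
    Integrable (fun x => ‖x - c‖⁻¹) F := by
  refine ⟨by fun_prop, lt_of_le_of_lt (lintegral_mono fun x => ?_) hF⟩
  rw [Real.enorm_of_nonneg (by positivity), ← ofReal_norm]
  exact ENNReal.ofReal_inv_le

lemma integrable_rpow_norm_sub (hF : ∫⁻ x, ‖x - c‖ₑ⁻¹ ∂F < ∞)
    (hF' : ∫⁻ x, ‖x - c‖ₑ ^ (-(3 / 2) : ℝ) ∂F < ∞) :
    Integrable (fun x => ‖x - c‖ ^ (-(3 / 2) : ℝ)) F := by
  have hm : Measurable fun x => ‖x - c‖ ^ (-(3 / 2) : ℝ) := by fun_prop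
  refine ⟨hm.aestronglyMeasurable, lt_of_le_of_lt (lintegral_mono_ae ?_) hF'⟩
  filter_upwards [ae_sub_ne_zero hF] with x hx
  rw [Real.enorm_of_nonneg (by positivity), ← ofReal_norm,
    ENNReal.ofReal_rpow_of_pos (norm_pos_iff.2 hx)]

variable {Ω : Type*} [MeasurableSpace Ω] {P : Measure Ω}
  {X : ℕ → Ω → EuclideanSpace ℝ (Fin p)} {T : ℕ → Ω → EuclideanSpace ℝ (Fin p)}

lemma ae_forall_sub_ne_zero (hX : ∀ i, HasLaw (X i) F P) (hF : ∫⁻ x, ‖x - c‖ₑ⁻¹ ∂F < ∞) :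
    ∀ᵐ ω ∂P, ∀ k, X k ω - c ≠ 0 := by
  rw [ae_all_iff]
  intro k
  refine ae_of_ae_map (hX k).aemeasurable (p := fun x => x - c ≠ 0) ?_
  rw [(hX k).map_eq]
  exact ae_sub_ne_zero hF

lemma integrable_signOuter [IsFiniteMeasure F] (i j : Fin p) :
    Integrable (fun x => signOuter (x - c) i j) F :=
  Integrable.of_bound (Measurable.aestronglyMeasurable (by fun_prop)) 1 (ae_of_all _ fun x => by
    simpa using abs_signOuter_le_one (x - c) i j)

lemma tendsto_empiricalSSCM_of_tendsto [IsFiniteMeasure F]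
    (hX : ∀ i, HasLaw (X i) F P) (hindep : iIndepFun X P)
    (hF : ∫⁻ x, ‖x - c‖ₑ⁻¹ ∂F < ∞)
    (hT : ∀ᵐ ω ∂P, Tendsto (fun n => T n ω) atTop (𝓝 c)) :
    ∀ᵐ ω ∂P, Tendsto (fun n : ℕ => empiricalSSCM (fun k : Fin n => X k ω) (T n ω)) atTop
      (𝓝 (Matrix.of fun i j => ∫ x, signOuter (x - c) i j ∂F)) := by
  have hslln : ∀ᵐ ω ∂P, ∀ i j, Tendsto
      (fun n : ℕ => (n : ℝ)⁻¹ * ∑ k ∈ Finset.range n, signOuter (X k ω - c) i j) atTop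
      (𝓝 (∫ x, signOuter (x - c) i j ∂F)) := by
    simp_rw [ae_all_iff]
    exact fun i j => tendsto_average_ae hX hindep (f := fun x => signOuter (x - c) i j)
      (by fun_prop) (integrable_signOuter i j)
  have hinv := tendsto_average_ae hX hindep (f := fun x => ‖x - c‖⁻¹) (by fun_prop)
    (integrable_inv_norm_sub hF)
  filter_upwards [hslln, hinv, hT, ae_forall_sub_ne_zero hX hF] with ω h1 h2 h3 h4
  refine tendsto_pi_nhds.2 fun i => tendsto_pi_nhds.2 fun j => ?_
  have hu : Tendsto (fun n => ‖T n ω - c‖) atTop (𝓝 0) := by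
    simpa using (h3.sub_const c).norm
  have hb := (hu.mul h2).const_mul 6
  rw [zero_mul, mul_zero] at hb
  have hdiff : Tendsto (fun n : ℕ => empiricalSSCM (fun k : Fin n => X k ω) (T n ω) i j
      - (n : ℝ)⁻¹ * ∑ k ∈ Finset.range n, signOuter (X k ω - c) i j) atTop (𝓝 0) := by
    refine squeeze_zero_norm (fun n => ?_) hb
    rw [empiricalSSCM_apply, ← mul_sub, ← Finset.sum_sub_distrib, Real.norm_eq_abs, abs_mul,
      abs_of_nonneg (by positivity : (0 : ℝ) ≤ (n : ℝ)⁻¹)]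
    calc (n : ℝ)⁻¹ * |∑ k ∈ Finset.range n,
          (signOuter (X k ω - T n ω) i j - signOuter (X k ω - c) i j)|
        ≤ (n : ℝ)⁻¹ * ∑ k ∈ Finset.range n, 6 * (‖T n ω - c‖ * ‖X k ω - c‖⁻¹) := by
          gcongr
          refine (Finset.abs_sum_le_sum_abs _ _).trans (Finset.sum_le_sum fun k _ => ?_)
          have := abs_signOuter_sub_le (h4 k) (T n ω - c) i j
          rwa [sub_sub_sub_cancel_right] at this
      _ = _ := by
          simp_rw [← Finset.mul_sum]
          ring
  have := hdiff.add (h1 i j)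
  simpa using this

lemma integral_eq_zero_of_odd
    (hsymm : F.map (fun x => x - c) = F.map (fun x => -(x - c)))
    {f : EuclideanSpace ℝ (Fin p) → ℝ} (hf : Measurable f) (hodd : ∀ y, f (-y) = -f y) :
    ∫ x, f (x - c) ∂F = 0 := by
  have h1 : ∫ x, f (x - c) ∂F = ∫ y, f y ∂(F.map fun x => x - c) :=
    (integral_map (by fun_prop) hf.aestronglyMeasurable).symm
  have h2 : ∫ y, f y ∂(F.map fun x => -(x - c)) = ∫ x, f (-(x - c)) ∂F :=
    integral_map (by fun_prop) hf.aestronglyMeasurable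
  have h3 : ∫ x, f (x - c) ∂F = -∫ x, f (x - c) ∂F := by
    conv_lhs => rw [h1, hsymm, h2]
    simp_rw [hodd, integral_neg]
  linarith

lemma integrable_signOuterDeriv (hF : ∫⁻ x, ‖x - c‖ₑ⁻¹ ∂F < ∞) (i j k : Fin p) :
    Integrable (fun x => signOuterDeriv i j k (x - c)) F := by
  refine ((integrable_inv_norm_sub hF).const_mul 4).mono' (Measurable.aestronglyMeasurable
    ((measurable_signOuterDeriv i j k).comp (by fun_prop))) (ae_of_all _ fun x => ?_)
  exact abs_signOuterDeriv_le i j k (x - c)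

lemma norm_vecE_le (A : Matrix (Fin p) (Fin p) ℝ) : ‖vecE A‖ ≤ ∑ i, ∑ j, |A i j| := by
  have h : vecE A = ∑ q : Fin p × Fin p, EuclideanSpace.single q (A q.2 q.1) := by
    ext r
    simp [vecE, Matrix.vec]
  rw [h]
  refine (norm_sum_le _ _).trans_eq ?_
  simp only [PiLp.norm_single, Real.norm_eq_abs]
  rw [Fintype.sum_prod_type, Finset.sum_comm]

/-- Replacing the location estimate by its limit does not affect the asymptotic distribution. -/
lemma tendstoInMeasure_sqrt_smul_sub [IsProbabilityMeasure P] [IsFiniteMeasure F]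
    (hX : ∀ i, HasLaw (X i) F P) (hindep : iIndepFun X P)
    (hF : ∫⁻ x, ‖x - c‖ₑ⁻¹ ∂F < ∞) (hTmeas : ∀ n, AEMeasurable (T n) P)
    (hT : ∀ᵐ ω ∂P, Tendsto (fun n => T n ω) atTop (𝓝 c))
    {ν : Measure ℝ} [IsProbabilityMeasure ν]
    (hν : TendstoInDistribution (fun (n : ℕ) ω => √(n : ℝ) * ‖T n ω - c‖) atTop id (fun _ => P) ν)
    (hF' : ∫⁻ x, ‖x - c‖ₑ ^ (-(3 / 2) : ℝ) ∂F < ∞)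
    (hsymm : F.map (fun x => x - c) = F.map (fun x => -(x - c))) :
    TendstoInMeasure P (fun (n : ℕ) ω => √(n : ℝ) •
      vecE (empiricalSSCM (fun k : Fin n => X k ω) (T n ω)
        - empiricalSSCM (fun k : Fin n => X k ω) c)) atTop 0 := by
  have hXm : ∀ i, AEMeasurable (X i) P := fun i => (hX i).aemeasurable
  -- `D` averages the linear coefficients and tends to 0 by symmetry; `R` averages the remainder
  -- weights and only has to converge.
  let D : Fin p → Fin p → Fin p → ℕ → Ω → ℝ := fun i j k n ω =>
    |(n : ℝ)⁻¹ * ∑ l ∈ Finset.range n, signOuterDeriv i j k (X l ω - c)|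
  let R : ℕ → Ω → ℝ := fun n ω =>
    (n : ℝ)⁻¹ * ∑ l ∈ Finset.range n, ‖X l ω - c‖ ^ (-(3 / 2) : ℝ)
  refine tendstoInMeasure_zero_of_norm_le_mul hν
    (A := fun n ω => ∑ i, ∑ j, (∑ k, D i j k n ω + 14 * (‖T n ω - c‖ ^ (1 / 2 : ℝ) * R n ω)))
    (fun n => ?_) ?_ (fun n => ?_)
  · have hD : ∀ i j k, AEMeasurable (D i j k n) P := fun i j k =>
      ((Finset.aemeasurable_fun_sum _ fun l _ =>
        (measurable_signOuterDeriv i j k).comp_aemeasurable ((hXm l).sub_const c)).const_mul _).norm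
    have hR : AEMeasurable (R n) P := AEMeasurable.const_mul
      (Finset.aemeasurable_fun_sum _ fun l _ => (((hXm l).sub_const c).norm.pow_const _)) _
    refine Finset.aemeasurable_fun_sum _ fun i _ => Finset.aemeasurable_fun_sum _ fun j _ => ?_
    exact (Finset.aemeasurable_fun_sum _ fun k _ => hD i j k).add
      (((((hTmeas n).sub_const c).norm.pow_const _).mul hR).const_mul _)
  · have hD0 : ∀ᵐ ω ∂P, ∀ i j k, Tendsto (fun n => D i j k n ω) atTop (𝓝 0) := by
      simp_rw [ae_all_iff]
      intro i j k
      have := tendsto_average_ae hX hindep (f := fun x => signOuterDeriv i j k (x - c))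
        ((measurable_signOuterDeriv i j k).comp (by fun_prop)) (integrable_signOuterDeriv hF i j k)
      rw [integral_eq_zero_of_odd hsymm (measurable_signOuterDeriv i j k)
        (signOuterDeriv_neg i j k)] at this
      filter_upwards [this] with ω hω
      have := hω.abs
      rwa [abs_zero] at this
    have hR := tendsto_average_ae hX hindep (f := fun x => ‖x - c‖ ^ (-(3 / 2) : ℝ))
      (by fun_prop) (integrable_rpow_norm_sub hF hF')
    filter_upwards [hD0, hR, hT] with ω h1 h2 h3
    have hu : Tendsto (fun n => ‖T n ω - c‖) atTop (𝓝 0) := by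
      simpa using (h3.sub_const c).norm
    have hu2 := hu.rpow_const (p := 1 / 2) (Or.inr (by norm_num))
    rw [Real.zero_rpow (by norm_num)] at hu2
    have h5 := (hu2.mul h2).const_mul 14
    have := tendsto_finsetSum Finset.univ fun i (_ : i ∈ (Finset.univ : Finset (Fin p))) =>
      tendsto_finsetSum Finset.univ fun j (_ : j ∈ (Finset.univ : Finset (Fin p))) =>
        (tendsto_finsetSum Finset.univ fun k (_ : k ∈ (Finset.univ : Finset (Fin p))) =>
          h1 i j k).add h5
    simpa using this
  · filter_upwards [ae_forall_sub_ne_zero hX hF] with ω h4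
    set u := T n ω - c with hu
    rw [norm_smul, Real.norm_of_nonneg (Real.sqrt_nonneg _), mul_assoc]
    refine mul_le_mul_of_nonneg_left ?_ (Real.sqrt_nonneg _)
    refine (norm_vecE_le _).trans ?_
    rw [Finset.mul_sum]
    refine Finset.sum_le_sum fun i _ => ?_
    rw [Finset.mul_sum]
    refine Finset.sum_le_sum fun j _ => ?_
    rw [Matrix.sub_apply, empiricalSSCM_apply, empiricalSSCM_apply, ← mul_sub,
      ← Finset.sum_sub_distrib]
    have hn : (0 : ℝ) ≤ (n : ℝ)⁻¹ := by positivity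
    have hsplit : (n : ℝ)⁻¹ * ∑ l ∈ Finset.range n,
        (signOuter (X l ω - T n ω) i j - signOuter (X l ω - c) i j)
        = ∑ k, ((n : ℝ)⁻¹ * ∑ l ∈ Finset.range n, signOuterDeriv i j k (X l ω - c)) * u k
          + (n : ℝ)⁻¹ * ∑ l ∈ Finset.range n, (signOuter (X l ω - c - u) i j
            - signOuter (X l ω - c) i j - ∑ k, signOuterDeriv i j k (X l ω - c) * u k) := by
      have h1 : ∑ k, ((n : ℝ)⁻¹ * ∑ l ∈ Finset.range n, signOuterDeriv i j k (X l ω - c)) * u k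
          = (n : ℝ)⁻¹ * ∑ l ∈ Finset.range n, ∑ k, signOuterDeriv i j k (X l ω - c) * u k := by
        rw [Finset.sum_comm, Finset.mul_sum]
        simp_rw [mul_assoc, Finset.sum_mul]
      rw [h1, ← mul_add, ← Finset.sum_add_distrib]
      simp [hu]
    rw [hsplit]
    refine (abs_add_le _ _).trans ?_
    rw [mul_add, Finset.mul_sum Finset.univ fun k => D i j k n ω]
    refine add_le_add ?_ ?_
    · refine (Finset.abs_sum_le_sum_abs _ _).trans (Finset.sum_le_sum fun k _ => ?_)
      rw [abs_mul, mul_comm]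
      exact mul_le_mul_of_nonneg_right (abs_apply_le_norm u k) (abs_nonneg _)
    · rw [abs_mul, abs_of_nonneg hn]
      calc _ ≤ (n : ℝ)⁻¹ * ∑ l ∈ Finset.range n,
            14 * (‖u‖ ^ (3 / 2 : ℝ) * ‖X l ω - c‖ ^ (-(3 / 2) : ℝ)) := by
            gcongr
            refine (Finset.abs_sum_le_sum_abs _ _).trans (Finset.sum_le_sum fun l _ => ?_)
            exact abs_signOuter_sub_sub_deriv_le (h4 l) u i j
        _ = _ := by
            -- One factor `‖u‖` is absorbed by `√n`; the leftover square root tends to 0 and kills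
            -- `R`.
            have : ‖u‖ ^ (3 / 2 : ℝ) = ‖u‖ * ‖u‖ ^ (1 / 2 : ℝ) := by
              conv_rhs => rw [← Real.rpow_one_add' (norm_nonneg u) (by norm_num)]
              norm_num
            simp only [R, this, ← Finset.mul_sum]
            ring

/-- The covariance matrix of `vec (s(x - c) s(x - c)ᵀ)` under `F`. -/
def signCov (F : Measure (EuclideanSpace ℝ (Fin p))) (c : EuclideanSpace ℝ (Fin p)) :
    Matrix (Fin p × Fin p) (Fin p × Fin p) ℝ :=
  covMatrix F fun x => vecE (signOuter (x - c))

lemma measurable_vecE_signOuter :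
    Measurable fun x : EuclideanSpace ℝ (Fin p) => vecE (signOuter (x - c)) := by
  unfold vecE
  refine (WithLp.measurable_toLp 2 _).comp (measurable_pi_lambda _ fun q => ?_)
  simp only [Matrix.vec]
  fun_prop

lemma memLp_vecE_signOuter [IsFiniteMeasure F] :
    MemLp (fun x => vecE (signOuter (x - c))) 2 F := by
  refine MemLp.of_bound measurable_vecE_signOuter.aestronglyMeasurable (∑ _i : Fin p, ∑ _j : Fin p, 1)
    (ae_of_all _ fun x => (norm_vecE_le _).trans ?_)
  gcongr
  exact abs_signOuter_le_one _ _ _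

lemma vecE_sub (A B : Matrix (Fin p) (Fin p) ℝ) : vecE (A - B) = vecE A - vecE B := rfl

/-- The central limit theorem for the spatial sign covariance matrix with known location. -/
lemma tendstoInDistribution_sqrt_smul_vecE [IsProbabilityMeasure P] [IsProbabilityMeasure F]
    (hX : ∀ i, HasLaw (X i) F P) (hindep : iIndepFun X P) :
    TendstoInDistribution
      (fun (n : ℕ) ω => √(n : ℝ) • vecE (empiricalSSCM (fun k : Fin n => X k ω) c
        - Matrix.of fun i j => ∫ x, signOuter (x - c) i j ∂F))
      atTop id (fun _ => P) (multivariateGaussian 0 (signCov F c)) := by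
  let f : EuclideanSpace ℝ (Fin p) → EuclideanSpace ℝ (Fin p × Fin p) :=
    fun x => vecE (signOuter (x - c))
  have hf : Measurable f := measurable_vecE_signOuter
  have hid : ∀ i, IdentDistrib (f ∘ X i) (f ∘ X 0) P P := fun i =>
    IdentDistrib.comp ⟨(hX i).aemeasurable, (hX 0).aemeasurable,
      by rw [(hX i).map_eq, (hX 0).map_eq]⟩ hf
  have hL : MemLp (f ∘ X 0) 2 P := by
    have : MemLp f 2 (P.map (X 0)) := by
      rw [(hX 0).map_eq]
      exact memLp_vecE_signOuter
    exact this.comp_of_map (hX 0).aemeasurable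
  have hclt := tendstoInDistribution_multivariate hL (hindep.comp (fun _ => f) fun _ => hf) hid
  have hcov : covMatrix P (f ∘ X 0) = signCov F c := by
    ext q r
    simp only [covMatrix, signCov, Matrix.of_apply]
    exact (hX 0).covariance_fun_comp (f := fun x => f x q) (g := fun x => f x r)
      (by fun_prop) (by fun_prop)
  have hE : P[f ∘ X 0] = vecE (Matrix.of fun i j => ∫ x, signOuter (x - c) i j ∂F) := by
    rw [(hX 0).integral_comp hf.aestronglyMeasurable]
    have hint : Integrable f F := memLp_vecE_signOuter.integrable (by norm_num)
    ext q
    exact ((EuclideanSpace.proj (𝕜 := ℝ) q : EuclideanSpace ℝ (Fin p × Fin p) →L[ℝ] ℝ)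
      |>.integral_comp_comm hint).symm
  rw [hE] at hclt
  simp only [hcov] at hclt
  refine hclt.congr (fun n => ae_of_all _ fun ω => ?_) (ae_of_all _ fun _ => rfl)
  rcases Nat.eq_zero_or_pos n with rfl | hn
  · simp
  have hn' : (0 : ℝ) < n := by exact_mod_cast hn
  have hemp : vecE (empiricalSSCM (fun k : Fin n => X k ω) c)
      = (n : ℝ)⁻¹ • ∑ k ∈ Finset.range n, f (X k ω) := by
    ext q
    simp [vecE, Matrix.vec, empiricalSSCM_apply, f]
  have hsq : (√(n : ℝ))⁻¹ = √(n : ℝ) * (n : ℝ)⁻¹ := by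
    rw [← Real.sqrt_div_self, div_eq_mul_inv]
  beta_reduce
  rw [vecE_sub, hemp, hsq, mul_smul, smul_sub _ _ ((n : ℝ) • _), inv_smul_smul₀ hn'.ne']
  rfl

lemma aemeasurable_sqrt_smul_vecE (hX : ∀ i, AEMeasurable (X i) P)
    (hT : ∀ n, AEMeasurable (T n) P) (S : Matrix (Fin p) (Fin p) ℝ) (n : ℕ) :
    AEMeasurable (fun ω => √(n : ℝ) •
      vecE (empiricalSSCM (fun k : Fin n => X k ω) (T n ω) - S)) P := by
  refine AEMeasurable.fun_const_smul ?_ _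
  unfold vecE
  refine (WithLp.measurable_toLp 2 _).comp_aemeasurable (aemeasurable_pi_lambda _ fun q => ?_)
  simp only [Matrix.vec, Matrix.sub_apply, empiricalSSCM_apply]
  refine AEMeasurable.sub_const (AEMeasurable.const_mul
    (Finset.aemeasurable_fun_sum _ fun k _ => ?_) _) _
  exact (measurable_signOuter_apply q.2 q.1).comp_aemeasurable ((hX k).sub (hT n))

/-- Asymptotic normality of the spatial sign covariance matrix with estimated location. -/
theorem tendstoInDistribution_empiricalSSCM [IsProbabilityMeasure P] [IsProbabilityMeasure F]
    (hX : ∀ i, HasLaw (X i) F P) (hindep : iIndepFun X P)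
    (hF : ∫⁻ x, ‖x - c‖ₑ⁻¹ ∂F < ∞) (hTmeas : ∀ n, AEMeasurable (T n) P)
    (hT : ∀ᵐ ω ∂P, Tendsto (fun n => T n ω) atTop (𝓝 c))
    {ν : Measure ℝ} [IsProbabilityMeasure ν]
    (hν : TendstoInDistribution (fun (n : ℕ) ω => √(n : ℝ) * ‖T n ω - c‖) atTop id (fun _ => P) ν)
    (hF' : ∫⁻ x, ‖x - c‖ₑ ^ (-(3 / 2) : ℝ) ∂F < ∞)
    (hsymm : F.map (fun x => x - c) = F.map (fun x => -(x - c))) :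
    TendstoInDistribution
      (fun (n : ℕ) ω => √(n : ℝ) • vecE (empiricalSSCM (fun k : Fin n => X k ω) (T n ω)
        - Matrix.of fun i j => ∫ x, signOuter (x - c) i j ∂F))
      atTop id (fun _ => P) (multivariateGaussian 0 (signCov F c)) := by
  refine tendstoInDistribution_of_tendstoInMeasure_sub _ _
    (tendstoInDistribution_sqrt_smul_vecE (c := c) hX hindep) ?_
    (aemeasurable_sqrt_smul_vecE (fun i => (hX i).aemeasurable) hTmeas _)
  refine (tendstoInMeasure_sqrt_smul_sub hX hindep hF hTmeas hT hν hF' hsymm).congr_left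
    fun n => ae_of_all _ fun ω => ?_
  simp only [Pi.sub_apply, ← smul_sub, ← vecE_sub, sub_sub_sub_cancel_right]

end Asymptotics

/-! ### Uniqueness of the center of symmetry -/

section Center

variable {p : ℕ} {F : Measure (EuclideanSpace ℝ (Fin p))}

/-- A probability measure is not invariant under a nontrivial translation. -/
lemma eq_zero_of_map_add_right_eq [IsProbabilityMeasure F] {v : EuclideanSpace ℝ (Fin p)}
    (h : F.map (fun x => x + v) = F) : v = 0 := by
  by_contra hv
  -- Poincaré recurrence: almost every point of a ball would return to it infinitely often, but the
  -- translates `x + n • v` escape every ball.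
  have hcons : Conservative (fun x => x + v) F :=
    MeasurePreserving.conservative ⟨by fun_prop, h⟩
  have hae : ∀ᵐ x ∂F, ∀ R : ℕ, x ∈ Metric.closedBall (0 : EuclideanSpace ℝ (Fin p)) R →
      ∃ᶠ n in atTop, (fun x => x + v)^[n] x ∈
        Metric.closedBall (0 : EuclideanSpace ℝ (Fin p)) R := by
    rw [ae_all_iff]
    exact fun R => hcons.ae_mem_imp_frequently_image_mem
      Metric.isClosed_closedBall.measurableSet.nullMeasurableSet
  obtain ⟨x, hx⟩ := hae.exists
  obtain ⟨R, hR⟩ := exists_nat_ge ‖x‖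
  refine hx R (by simpa using hR) ?_
  have hlim : Tendsto (fun n : ℕ => (n : ℝ) * ‖v‖) atTop atTop :=
    tendsto_natCast_atTop_atTop.atTop_mul_const (norm_pos_iff.2 hv)
  filter_upwards [hlim.eventually_gt_atTop (2 * R : ℝ)] with n hn hmem
  rw [add_right_iterate, mem_closedBall_zero_iff] at hmem
  have h1 : ‖n • v‖ ≤ ‖x + n • v‖ + ‖x‖ := by
    simpa using norm_sub_le (x + n • v) x
  rw [← Nat.cast_smul_eq_nsmul ℝ, norm_smul, Real.norm_natCast] at h1
  rw [← Nat.cast_smul_eq_nsmul ℝ] at hmem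
  linarith

lemma map_reflection_eq {c : EuclideanSpace ℝ (Fin p)}
    (hsymm : F.map (fun x => x - c) = F.map (fun x => -(x - c))) :
    F.map (fun x => (c + c) - x) = F := by
  have h := congrArg (Measure.map fun y => y + c) hsymm
  rw [Measure.map_map (by fun_prop) (by fun_prop),
    Measure.map_map (by fun_prop) (by fun_prop)] at h
  have h1 : (fun y => y + c) ∘ (fun x => x - c) = id := by ext x; simp
  have h2 : (fun y => y + c) ∘ (fun x => -(x - c)) = fun x => (c + c) - x := by
    ext x i
    simp
    ring
  rw [h1, h2, Measure.map_id] at h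
  exact h.symm

/-- The composition of the two point reflections is the translation by `2 (c - m)`, which preserves
`F`. -/
lemma center_unique [IsProbabilityMeasure F] {c m : EuclideanSpace ℝ (Fin p)}
    (hc : F.map (fun x => (c + c) - x) = F) (hm : F.map (fun x => (m + m) - x) = F) : c = m := by
  have h : F.map (fun x => x + ((2 : ℝ) • (c - m))) = F := by
    conv_rhs => rw [← hc, ← hm]
    rw [Measure.map_map (by fun_prop) (by fun_prop)]
    congr 1
    ext x i
    simp
    ring
  have h0 := eq_zero_of_map_add_right_eq h
  rw [smul_eq_zero] at h0
  exact sub_eq_zero.1 (h0.resolve_left two_ne_zero)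

/-- The reflection about `m` preserves Lebesgue measure, and the quadratic form in the density is
even. -/
lemma IsElliptical.map_reflection_eq {m : EuclideanSpace ℝ (Fin p)}
    {V : Matrix (Fin p) (Fin p) ℝ} (h : IsElliptical F m V) :
    F.map (fun x => (m + m) - x) = F := by
  obtain ⟨-, g, hg, -, rfl⟩ := h
  have hmp : MeasurePreserving (fun x : EuclideanSpace ℝ (Fin p) => (m + m) - x) volume volume :=
    Measure.measurePreserving_sub_left volume (m + m)
  ext s hs
  rw [Measure.map_apply hmp.measurable hs, withDensity_apply _ (hmp.measurable hs),
    withDensity_apply _ hs, ← hmp.setLIntegral_comp_preimage hs]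
  · refine lintegral_congr fun x => ?_
    have : m + m - x - m = -(x - m) := by abel
    rw [this, WithLp.ofLp_neg, Matrix.mulVec_neg, neg_dotProduct_neg]
  · simp only [dotProduct, Matrix.mulVec]
    fun_prop

end Center

/-! ### Linear change of variables to a spherical density -/

section Substitution

variable {p : ℕ}

lemma integral_comp_toEuclideanLin {A : Matrix (Fin p) (Fin p) ℝ} (hA : A.det ≠ 0)
    (h : EuclideanSpace ℝ (Fin p) → ℂ) :
    ∫ z, h (Matrix.toEuclideanLin A z) = |A.det|⁻¹ • ∫ y, h y := by
  have hdet : LinearMap.det (Matrix.toEuclideanLin A) = A.det := LinearMap.det_toLpLin _ _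
  have hmap := Measure.map_linearMap_addHaar_eq_smul_addHaar
    (volume : Measure (EuclideanSpace ℝ (Fin p))) (f := Matrix.toEuclideanLin A) (by rwa [hdet])
  let e := (LinearEquiv.ofIsUnitDet (f := Matrix.toEuclideanLin A)
    (v := (EuclideanSpace.basisFun (Fin p) ℝ).toBasis) (v' := (EuclideanSpace.basisFun (Fin p) ℝ).toBasis)
    (by rw [LinearMap.det_toMatrix, hdet]; exact hA.isUnit)).toContinuousLinearEquiv
  have he : ⇑e = Matrix.toEuclideanLin A := rfl
  have hemb : MeasurableEmbedding (Matrix.toEuclideanLin A) := by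
    rw [← he]
    exact e.toHomeomorph.measurableEmbedding
  rw [← hemb.integral_map, hmap, integral_smul_measure, hdet, ENNReal.toReal_ofReal (abs_nonneg _),
    abs_inv]

/-- Reduction of an elliptical distribution to a spherical one. -/
lemma IsElliptical.exists_integral_eq {F : Measure (EuclideanSpace ℝ (Fin p))}
    {m : EuclideanSpace ℝ (Fin p)} {V A : Matrix (Fin p) (Fin p) ℝ} (h : IsElliptical F m V)
    (hV : V = A * Aᵀ) :
    ∃ g : ℝ → ℝ, ∀ f : EuclideanSpace ℝ (Fin p) → ℂ,
      ∫ x, f (x - m) ∂F = ∫ z, g (‖z‖ ^ 2) • f (Matrix.toEuclideanLin A z) := by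
  obtain ⟨hpos, g, hg, hg0, rfl⟩ := h
  have hdetV : V.det = A.det ^ 2 := by rw [hV, Matrix.det_mul, Matrix.det_transpose, sq]
  have hA : A.det ≠ 0 := by
    intro h0
    have := hpos.det_pos
    rw [hdetV, h0] at this
    norm_num at this
  have hAu : IsUnit A.det := hA.isUnit
  refine ⟨g, fun f => ?_⟩
  rw [integral_withDensity_eq_integral_toReal_smul
    (by simp only [dotProduct, Matrix.mulVec]; fun_prop) (ae_of_all _ fun _ => ENNReal.ofReal_lt_top)]
  have hnn : ∀ x : EuclideanSpace ℝ (Fin p),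
      0 ≤ (√V.det)⁻¹ * g (x.ofLp ⬝ᵥ (V⁻¹ *ᵥ x.ofLp)) :=
    fun x => mul_nonneg (by positivity) (hg0 _)
  simp_rw [ENNReal.toReal_ofReal (hnn _)]
  rw [integral_sub_right_eq_self (μ := volume) (fun y : EuclideanSpace ℝ (Fin p) =>
    ((√V.det)⁻¹ * g (y.ofLp ⬝ᵥ (V⁻¹ *ᵥ y.ofLp))) • f y) m]
  -- The inverse of `A * Aᵀ` undoes `A` on both sides. The normalizing factor `(√V.det)⁻¹` is
  -- exactly the Jacobian factor `|A.det|⁻¹`.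
  have hquad : ∀ z : EuclideanSpace ℝ (Fin p), (Matrix.toEuclideanLin A z).ofLp ⬝ᵥ
      (V⁻¹ *ᵥ (Matrix.toEuclideanLin A z).ofLp) = ‖z‖ ^ 2 := by
    intro z
    rw [Matrix.ofLp_toLpLin, Matrix.toLin'_apply, Matrix.mulVec_mulVec, hV, Matrix.mul_inv_rev,
      Matrix.mul_assoc, Matrix.nonsing_inv_mul _ hAu, Matrix.mul_one, ← Matrix.vecMul_transpose A,
      ← Matrix.dotProduct_mulVec, Matrix.mulVec_mulVec,
      Matrix.mul_nonsing_inv _ (by rwa [Matrix.det_transpose]), Matrix.one_mulVec,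
      EuclideanSpace.real_norm_sq_eq]
    simp [dotProduct, sq]
  have hsub := integral_comp_toEuclideanLin hA (fun y : EuclideanSpace ℝ (Fin p) =>
    g (y.ofLp ⬝ᵥ (V⁻¹ *ᵥ y.ofLp)) • f y)
  simp_rw [hquad] at hsub
  rw [hsub, ← integral_smul, hdetV, Real.sqrt_sq_eq_abs]
  simp_rw [mul_smul]

end Substitution

/-! ### Separation of radius and angle -/

section Polar

open Real in
-- The radial integral stays an unevaluated constant, to be eliminated later by total mass one.
lemma integral_radial_smul (g : ℝ → ℝ) {f : ℂ → ℂ}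
    (hf : ∀ r : ℝ, 0 < r → ∀ z, f (r * z) = f z) :
    ∫ z : ℂ, g (‖z‖ ^ 2) • f z =
      (∫ r in Set.Ioi (0 : ℝ), ((r * g (r ^ 2) : ℝ) : ℂ)) *
        ∫ θ in Set.Ioo (-π) π, f (Real.cos θ + Real.sin θ * Complex.I) := by
  rw [← Complex.integral_comp_polarCoord_symm, polarCoord_target, Measure.volume_eq_prod,
    ← setIntegral_prod_mul]
  refine setIntegral_congr_fun (measurableSet_Ioi.prod measurableSet_Ioo) fun q hq => ?_
  have hr : 0 < q.1 := hq.1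
  rw [Complex.norm_polarCoord_symm, Complex.polarCoord_symm_apply, hf q.1 hr, sq_abs,
    Complex.real_smul, Complex.real_smul]
  push_cast
  ring

end Polar

/-! ### Ellipse averages by the mean value property -/

section MeanValue

open Real Complex

/-- The mean over the ellipse of the powers of the squared direction. -/
lemma integral_ellipse_div_conj_pow {a b : ℝ} (ha : 0 < a) (hb : 0 < b) (k : ℕ) :
    ∫ θ in Set.Ioo (-π) π, (((a * Real.cos θ : ℝ) + (b * Real.sin θ : ℝ) * I : ℂ) /
      ((a * Real.cos θ : ℝ) - (b * Real.sin θ : ℝ) * I)) ^ k =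
        2 * π * (((a - b) / (a + b) : ℝ) : ℂ) ^ k := by
  -- For `w = exp (iθ)`, multiplying numerator and denominator of the integrand by `2 w` gives `h
  -- w`. Since `|a - b| < a + b`, the poles lie outside the closed disc, so the circle average is `h
  -- 0`.
  set h : ℂ → ℂ := fun w => (((a + b : ℝ) * w ^ 2 + (a - b : ℝ)) /
    ((a + b : ℝ) + (a - b : ℝ) * w ^ 2)) ^ k with hh
  have hden : ∀ w ∈ Metric.closedBall (0 : ℂ) 1, ((a + b : ℝ) : ℂ) + (a - b : ℝ) * w ^ 2 ≠ 0 := by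
    intro w hw h0
    rw [mem_closedBall_zero_iff] at hw
    have h1 : ‖((a + b : ℝ) : ℂ)‖ = ‖((a - b : ℝ) : ℂ) * w ^ 2‖ := by
      rw [eq_neg_of_add_eq_zero_left h0, norm_neg]
    rw [norm_mul, norm_pow, norm_real, norm_real, Real.norm_of_nonneg (by positivity)] at h1
    have h2 : ‖a - b‖ < a + b := by
      rw [Real.norm_eq_abs, abs_lt]
      constructor <;> linarith
    have h3 : ‖w‖ ^ 2 ≤ 1 := pow_le_one₀ (norm_nonneg _) hw
    nlinarith [norm_nonneg (a - b)]
  have hdiff : DiffContOnCl ℂ h (Metric.ball 0 |1|) := by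
    rw [abs_one]
    refine DifferentiableOn.diffContOnCl_ball (U := Metric.closedBall 0 1) (fun w hw => ?_) le_rfl
    refine DifferentiableAt.differentiableWithinAt ?_
    have h1 : DifferentiableAt ℂ (fun w : ℂ => ((a + b : ℝ) : ℂ) * w ^ 2 + (a - b : ℝ)) w := by
      fun_prop
    have h2 : DifferentiableAt ℂ (fun w : ℂ => ((a + b : ℝ) : ℂ) + (a - b : ℝ) * w ^ 2) w := by
      fun_prop
    exact (h1.fun_div h2 (hden w hw)).fun_pow k
  have havg := hdiff.circleAverage
  rw [Real.circleAverage_eq_integral_add (-π)] at havg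
  have hpi : (0 : ℝ) < π := Real.pi_pos
  have hshift : ∫ θ in (0 : ℝ)..2 * π, h (circleMap 0 1 (θ + -π))
      = ∫ θ in (-π)..π, h (circleMap 0 1 θ) := by
    rw [intervalIntegral.integral_comp_add_right (fun θ => h (circleMap 0 1 θ))]
    congr 1 <;> ring
  rw [hshift, intervalIntegral.integral_of_le (by linarith), integral_Ioc_eq_integral_Ioo] at havg
  have hval : h 0 = (((a - b) / (a + b) : ℝ) : ℂ) ^ k := by simp [hh]
  rw [← hval, ← havg, Complex.real_smul]
  have hcancel : ∀ J : ℂ, 2 * (π : ℂ) * (((2 * π)⁻¹ : ℝ) * J) = J := by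
    intro J
    have : (π : ℂ) ≠ 0 := by exact_mod_cast hpi.ne'
    push_cast
    field_simp
  rw [hcancel]
  refine setIntegral_congr_fun measurableSet_Ioo fun θ _ => ?_
  have hw : circleMap 0 1 θ ∈ Metric.closedBall (0 : ℂ) 1 := by simp
  have hd := hden _ hw
  simp only [hh]
  have hcm : circleMap 0 1 θ = Complex.cos θ + Complex.sin θ * I := by
    simp [circleMap, Complex.exp_mul_I]
  rw [hcm] at hd ⊢
  congr 1
  set x := Complex.cos θ
  set y := Complex.sin θ
  have hxy : x ^ 2 + y ^ 2 = 1 := by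
    rw [add_comm]
    exact Complex.sin_sq_add_cos_sq (θ : ℂ)
  have e1 : (((a + b : ℝ) : ℂ) * (x + y * I) ^ 2 + (a - b : ℝ))
      = 2 * (x + y * I) * (a * x + b * y * I) := by
    push_cast
    linear_combination (-(a - b) : ℂ) * hxy + (a - b) * y ^ 2 * I_sq
  have e2 : (((a + b : ℝ) : ℂ) + (a - b : ℝ) * (x + y * I) ^ 2)
      = 2 * (x + y * I) * (a * x - b * y * I) := by
    push_cast
    linear_combination (-(a + b) : ℂ) * hxy + (a + b) * y ^ 2 * I_sq
  rw [e2] at hd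
  rw [e1, e2]
  have hd1 : 2 * (x + y * I) ≠ 0 := left_ne_zero_of_mul hd
  rw [mul_div_mul_left _ _ hd1]
  simp [x, y]

end MeanValue

/-! ### Covariances on the unit circle -/

section UnitComplex

variable {α : Type*} [MeasurableSpace α] {F : Measure α}

lemma covariance_congr_ae {X X' Y Y' : α → ℝ} (hX : X =ᵐ[F] X') (hY : Y =ᵐ[F] Y') :
    cov[X, Y; F] = cov[X', Y'; F] := by
  rw [covariance, covariance, integral_congr_ae hX, integral_congr_ae hY]
  refine integral_congr_ae ?_
  filter_upwards [hX, hY] with x hx hy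
  rw [hx, hy]

lemma memLp_re {ζ : α → ℂ} (hζ : MemLp ζ 2 F) : MemLp (fun x => (ζ x).re) 2 F :=
  Complex.reCLM.comp_memLp' hζ

lemma memLp_im {ζ : α → ℂ} (hζ : MemLp ζ 2 F) : MemLp (fun x => (ζ x).im) 2 F :=
  Complex.imCLM.comp_memLp' hζ

variable [IsProbabilityMeasure F]

/-- Covariances of the coordinates of a random point of the unit circle with real first two
trigonometric moments `κ` and `κ ^ 2`. -/
lemma covariance_coord_unitCircle {ζ : α → ℂ} (hm : Measurable ζ) (hnorm : ∀ᵐ x ∂F, ‖ζ x‖ = 1)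
    {κ : ℝ} (h1 : ∫ x, ζ x ∂F = κ) (h2 : ∫ x, ζ x ^ 2 ∂F = (κ : ℂ) ^ 2) :
    cov[fun x => (ζ x).re, fun x => (ζ x).re; F] = (1 - κ ^ 2) / 2 ∧
    cov[fun x => (ζ x).re, fun x => (ζ x).im; F] = 0 ∧
    cov[fun x => (ζ x).im, fun x => (ζ x).im; F] = (1 - κ ^ 2) / 2 := by
  have hL : MemLp ζ 2 F := MemLp.of_bound hm.aestronglyMeasurable 1 (hnorm.mono fun x hx => hx.le)
  have hre := memLp_re hL
  have him := memLp_im hL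
  have hζ1 : Integrable ζ F := hL.integrable (by norm_num)
  have hζ2 : Integrable (fun x => ζ x ^ 2) F :=
    Integrable.of_bound (hm.pow_const 2).aestronglyMeasurable 1
      (hnorm.mono fun x hx => by simp [hx])
  have e1 : ∫ x, (ζ x).re ∂F = κ := by
    have := Complex.reCLM.integral_comp_comm hζ1
    simpa [h1] using this
  have e2 : ∫ x, (ζ x).im ∂F = 0 := by
    have := Complex.imCLM.integral_comp_comm hζ1
    simpa [h1] using this
  have irr : Integrable (fun x => (ζ x).re * (ζ x).re) F := hre.integrable_mul hre
  have iii : Integrable (fun x => (ζ x).im * (ζ x).im) F := him.integrable_mul him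
  -- The real part of `ζ ^ 2` gives the difference of the second moments; `‖ζ‖ = 1` gives their sum
  -- in `e5`.
  have e3 : ∫ x, (ζ x).re * (ζ x).re ∂F - ∫ x, (ζ x).im * (ζ x).im ∂F = κ ^ 2 := by
    have := Complex.reCLM.integral_comp_comm hζ2
    rw [h2, ← Complex.ofReal_pow] at this
    rw [← integral_sub irr iii]
    simpa [sq] using this
  have e4 : ∫ x, (ζ x).re * (ζ x).im ∂F = 0 := by
    have := Complex.imCLM.integral_comp_comm hζ2
    rw [h2, ← Complex.ofReal_pow] at this
    have h5 : ∀ x, Complex.imCLM (ζ x ^ 2) = 2 * ((ζ x).re * (ζ x).im) := by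
      intro x
      simp [sq]
      ring
    simp_rw [h5, integral_const_mul] at this
    rw [Complex.imCLM_apply, Complex.ofReal_im] at this
    linarith
  have e5 : ∫ x, (ζ x).re * (ζ x).re ∂F + ∫ x, (ζ x).im * (ζ x).im ∂F = 1 := by
    rw [← integral_add irr iii]
    have : ∀ᵐ x ∂F, (ζ x).re * (ζ x).re + (ζ x).im * (ζ x).im = 1 := by
      filter_upwards [hnorm] with x hx
      rw [← Complex.normSq_apply, Complex.normSq_eq_norm_sq, hx, one_pow]
    rw [integral_congr_ae this]
    simp
  rw [covariance_eq_sub hre hre, covariance_eq_sub hre him, covariance_eq_sub him him]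
  simp only [Pi.mul_apply, e1, e2, e4]
  refine ⟨by linarith, by simp, by linarith⟩

/-- The covariance matrix of the real and imaginary parts is scalar, so only the inner product of
the coefficient vectors survives. -/
lemma covariance_affine_unitCircle {ζ : α → ℂ} (hm : Measurable ζ) (hnorm : ∀ᵐ x ∂F, ‖ζ x‖ = 1)
    {κ : ℝ} (h1 : ∫ x, ζ x ∂F = κ) (h2 : ∫ x, ζ x ^ 2 ∂F = (κ : ℂ) ^ 2)
    (k a b k' a' b' : ℝ) :
    cov[fun x => k + (a * (ζ x).re + b * (ζ x).im),
      fun x => k' + (a' * (ζ x).re + b' * (ζ x).im); F] =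
      (1 - κ ^ 2) / 2 * (a * a' + b * b') := by
  obtain ⟨c1, c2, c3⟩ := covariance_coord_unitCircle hm hnorm h1 h2
  have hL : MemLp ζ 2 F := MemLp.of_bound hm.aestronglyMeasurable 1 (hnorm.mono fun x hx => hx.le)
  have hre : ∀ a : ℝ, MemLp (fun x => a * (ζ x).re) 2 F := fun a => (memLp_re hL).const_mul a
  have him : ∀ a : ℝ, MemLp (fun x => a * (ζ x).im) 2 F := fun a => (memLp_im hL).const_mul a
  have hsum : ∀ a b : ℝ, MemLp (fun x => a * (ζ x).re + b * (ζ x).im) 2 F :=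
    fun a b => (hre a).add (him b)
  have c2' : cov[fun x => (ζ x).im, fun x => (ζ x).re; F] = 0 := by rw [covariance_comm, c2]
  rw [covariance_const_add_left ((hsum a b).integrable (by norm_num)),
    covariance_const_add_right ((hsum a' b').integrable (by norm_num))]
  have := covariance_add_left (hre a) (him b) (hsum a' b')
  have hl : cov[fun x => a * (ζ x).re, fun x => a' * (ζ x).re + b' * (ζ x).im; F] = _ :=
    covariance_add_right (hre a) (hre a') (him b')
  have hr : cov[fun x => b * (ζ x).im, fun x => a' * (ζ x).re + b' * (ζ x).im; F] = _ :=
    covariance_add_right (him b) (hre a') (him b')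
  refine this.trans ?_
  rw [hl, hr]
  simp only [covariance_const_mul_left, covariance_const_mul_right, c1, c2, c2', c3]
  ring

end UnitComplex

/-! ### The planar elliptical case -/

section Planar

/-- The complex number whose coordinates are those of `y` in the basis of the columns of `U`. -/
def planarCoord (U : Matrix (Fin 2) (Fin 2) ℝ) (y : EuclideanSpace ℝ (Fin 2)) : ℂ :=
  ((Uᵀ *ᵥ y.ofLp) 0 : ℝ) + ((Uᵀ *ᵥ y.ofLp) 1 : ℝ) * Complex.I

/-- The square of the direction of `z`. -/
def sqDirection (z : ℂ) : ℂ := z / starRingEnd ℂ z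

lemma sqDirection_mul {r : ℝ} (hr : 0 < r) (z : ℂ) : sqDirection (r * z) = sqDirection z := by
  have : (r : ℂ) ≠ 0 := by exact_mod_cast hr.ne'
  rw [sqDirection, map_mul, Complex.conj_ofReal, mul_div_mul_left _ _ this, sqDirection]

lemma norm_sqDirection {z : ℂ} (hz : z ≠ 0) : ‖sqDirection z‖ = 1 := by
  rw [sqDirection, norm_div, Complex.norm_conj, div_self (norm_ne_zero_iff.2 hz)]

lemma measurable_sqDirection_planarCoord (U : Matrix (Fin 2) (Fin 2) ℝ)
    (m : EuclideanSpace ℝ (Fin 2)) :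
    Measurable fun x => sqDirection (planarCoord U (x - m)) := by
  unfold sqDirection planarCoord
  simp only [Matrix.mulVec, dotProduct]
  fun_prop

lemma diagonal_sqrt_mul_self {lam : Fin 2 → ℝ} (h : ∀ i, 0 < lam i) :
    Matrix.diagonal (fun i => √(lam i)) * Matrix.diagonal (fun i => √(lam i))
      = Matrix.diagonal lam := by
  rw [Matrix.diagonal_mul_diagonal]
  congr 1
  ext i
  exact Real.mul_self_sqrt (h i).le

lemma pos_of_posDef {p : ℕ} {V U : Matrix (Fin p) (Fin p) ℝ} {lam : Fin p → ℝ} (hV : V.PosDef)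
    (hU : U ∈ Matrix.orthogonalGroup (Fin p) ℝ) (h : V = U * Matrix.diagonal lam * Uᵀ) (i : Fin p) :
    0 < lam i := by
  have hUU : Uᵀ * U = 1 := (Matrix.mem_orthogonalGroup_iff' _ _).1 hU
  have hinj : Function.Injective U.mulVec := by
    intro x y hxy
    have := congrArg (Uᵀ *ᵥ ·) hxy
    simpa [Matrix.mulVec_mulVec, hUU] using this
  have hd : Uᵀ * V * U = Matrix.diagonal lam := by
    rw [h]
    calc Uᵀ * (U * Matrix.diagonal lam * Uᵀ) * U
        = (Uᵀ * U) * Matrix.diagonal lam * (Uᵀ * U) := by simp only [Matrix.mul_assoc]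
      _ = Matrix.diagonal lam := by simp [hUU]
  have := hV.conjTranspose_mul_mul_same hinj
  rw [Matrix.conjTranspose_eq_transpose_of_trivial, hd] at this
  exact Matrix.posDef_diagonal_iff.1 this i

/-- The trigonometric moments of the direction of a planar elliptical distribution. -/
lemma IsElliptical.integral_sqDirection_pow {F : Measure (EuclideanSpace ℝ (Fin 2))}
    [IsProbabilityMeasure F] {m : EuclideanSpace ℝ (Fin 2)} {V U : Matrix (Fin 2) (Fin 2) ℝ}
    {lam : Fin 2 → ℝ} (h : IsElliptical F m V) (hU : U ∈ Matrix.orthogonalGroup (Fin 2) ℝ)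
    (hV : V = U * Matrix.diagonal lam * Uᵀ) (k : ℕ) :
    ∫ x, sqDirection (planarCoord U (x - m)) ^ k ∂F =
      (((√(lam 0) - √(lam 1)) / (√(lam 0) + √(lam 1)) : ℝ) : ℂ) ^ k := by
  have hpos := pos_of_posDef h.1 hU hV
  have hUU : Uᵀ * U = 1 := (Matrix.mem_orthogonalGroup_iff' _ _).1 hU
  set a := √(lam 0) with ha'
  set b := √(lam 1) with hb'
  have ha : 0 < a := Real.sqrt_pos.2 (hpos 0)
  have hb : 0 < b := Real.sqrt_pos.2 (hpos 1)
  set D := Matrix.diagonal (fun i => √(lam i)) with hD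
  have hVA : V = (U * D) * (U * D)ᵀ := by
    rw [hV, ← diagonal_sqrt_mul_self hpos, Matrix.transpose_mul, hD, Matrix.diagonal_transpose]
    simp only [Matrix.mul_assoc]
  obtain ⟨g, hg⟩ := h.exists_integral_eq hVA
  have hcoord : ∀ z : ℂ, planarCoord U (Matrix.toEuclideanLin (U * D)
      (Complex.orthonormalBasisOneI.repr z)) = (a * z.re : ℝ) + (b * z.im : ℝ) * Complex.I := by
    intro z
    rw [planarCoord, Matrix.ofLp_toLpLin, Matrix.toLin'_apply, Matrix.mulVec_mulVec,
      ← Matrix.mul_assoc, hUU, Matrix.one_mul, Complex.orthonormalBasisOneI_repr_apply]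
    simp [hD, Matrix.mulVec_diagonal, ha', hb']
  have key : ∀ k : ℕ, ∫ x, sqDirection (planarCoord U (x - m)) ^ k ∂F =
      (∫ r in Set.Ioi (0 : ℝ), ((r * g (r ^ 2) : ℝ) : ℂ)) *
        (2 * Real.pi * (((a - b) / (a + b) : ℝ) : ℂ) ^ k) := by
    intro k
    rw [hg fun y => sqDirection (planarCoord U y) ^ k,
      ← Complex.orthonormalBasisOneI.repr.measurePreserving.integral_comp
        Complex.orthonormalBasisOneI.repr.toHomeomorph.measurableEmbedding]
    simp_rw [LinearIsometryEquiv.norm_map, hcoord]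
    rw [integral_radial_smul g (f := fun z => sqDirection ((a * z.re : ℝ)
      + (b * z.im : ℝ) * Complex.I) ^ k), ← integral_ellipse_div_conj_pow ha hb]
    · congr 1
      refine setIntegral_congr_fun measurableSet_Ioo fun θ _ => ?_
      have hre : ((Real.cos θ : ℂ) + Real.sin θ * Complex.I).re = Real.cos θ := by
        simp [-Complex.ofReal_cos, -Complex.ofReal_sin]
      have him : ((Real.cos θ : ℂ) + Real.sin θ * Complex.I).im = Real.sin θ := by
        simp [-Complex.ofReal_cos, -Complex.ofReal_sin]
      simp only [sqDirection, hre, him, map_add, map_mul, Complex.conj_ofReal, Complex.conj_I,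
        mul_neg, ← sub_eq_add_neg]
    · intro r hr z
      have : (((a * (r * z : ℂ).re : ℝ) : ℂ) + (b * (r * z : ℂ).im : ℝ) * Complex.I)
          = r * ((a * z.re : ℝ) + (b * z.im : ℝ) * Complex.I) := by
        simp
        ring
      simp only [this, sqDirection_mul hr]
  -- The case `k = 0` says that the radial integral times `2π` is 1, which removes the unknown `g`.
  have h0 := key 0
  simp only [pow_zero, integral_const, probReal_univ, one_smul, mul_one] at h0
  rw [key k, ← mul_assoc, ← h0, one_mul]

/-- Double-angle formulas: if `Uᵀ y` has polar angle `φ`, the squared direction is `exp (2iφ)`, and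
the products of `cos φ` and `sin φ` are affine in its real and imaginary parts. -/
lemma signOuter_eq_sqDirection {U : Matrix (Fin 2) (Fin 2) ℝ}
    (hU : U ∈ Matrix.orthogonalGroup (Fin 2) ℝ) {y : EuclideanSpace ℝ (Fin 2)} (hy : y ≠ 0)
    (i j : Fin 2) :
    planarCoord U y ≠ 0 ∧
    signOuter y i j = (U i 0 * U j 0 + U i 1 * U j 1) / 2 +
      ((U i 0 * U j 0 - U i 1 * U j 1) / 2 * (sqDirection (planarCoord U y)).re +
        (U i 0 * U j 1 + U i 1 * U j 0) / 2 * (sqDirection (planarCoord U y)).im) := by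
  have hUU : U * Uᵀ = 1 := (Matrix.mem_orthogonalGroup_iff _ _).1 hU
  have hUU' : Uᵀ * U = 1 := (Matrix.mem_orthogonalGroup_iff' _ _).1 hU
  set d := Uᵀ *ᵥ y.ofLp with hd
  have hyd : y.ofLp = U *ᵥ d := by rw [hd, Matrix.mulVec_mulVec, hUU, Matrix.one_mulVec]
  have hyi : ∀ i, y i = U i 0 * d 0 + U i 1 * d 1 := by
    intro i
    rw [hyd]
    simp [Matrix.mulVec, dotProduct, Fin.sum_univ_two]
  have hN : ‖y‖ ^ 2 = d 0 ^ 2 + d 1 ^ 2 := by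
    have h00 := congrFun (congrFun hUU' 0) 0
    have h01 := congrFun (congrFun hUU' 0) 1
    have h11 := congrFun (congrFun hUU' 1) 1
    simp [Matrix.mul_apply, Fin.sum_univ_two] at h00 h01 h11
    rw [EuclideanSpace.real_norm_sq_eq, Fin.sum_univ_two, hyi, hyi]
    linear_combination d 0 ^ 2 * h00 + 2 * d 0 * d 1 * h01 + d 1 ^ 2 * h11
  have hNpos : 0 < d 0 ^ 2 + d 1 ^ 2 := by
    rw [← hN]
    have := norm_pos_iff.2 hy
    positivity
  have hz : planarCoord U y = (d 0 : ℂ) + (d 1 : ℂ) * Complex.I := rfl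
  have hsq : sqDirection (planarCoord U y) =
      (((d 0 ^ 2 - d 1 ^ 2) / (d 0 ^ 2 + d 1 ^ 2) : ℝ) : ℂ)
        + ((2 * d 0 * d 1 / (d 0 ^ 2 + d 1 ^ 2) : ℝ) : ℂ) * Complex.I := by
    have hne : ((d 0 ^ 2 + d 1 ^ 2 : ℝ) : ℂ) ≠ 0 := by exact_mod_cast hNpos.ne'
    have hfac : ((d 0 ^ 2 + d 1 ^ 2 : ℝ) : ℂ)
        = ((d 0 : ℂ) - d 1 * Complex.I) * ((d 0 : ℂ) + d 1 * Complex.I) := by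
      push_cast
      linear_combination (d 1 : ℂ) ^ 2 * Complex.I_sq
    have hconj : (starRingEnd ℂ) ((d 0 : ℂ) + (d 1 : ℂ) * Complex.I)
        = (d 0 : ℂ) - d 1 * Complex.I := by
      simp [sub_eq_add_neg]
    have hcne : (d 0 : ℂ) - d 1 * Complex.I ≠ 0 := left_ne_zero_of_mul (hfac ▸ hne)
    rw [sqDirection, hz, hconj, div_eq_iff hcne]
    have hne' : (d 0 : ℂ) ^ 2 + (d 1 : ℂ) ^ 2 ≠ 0 := by exact_mod_cast hNpos.ne'
    push_cast
    field_simp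
    linear_combination (2 * d 0 * (d 1 : ℂ) ^ 2) * Complex.I_sq
  refine ⟨fun h0 => ?_, ?_⟩
  · rw [hz] at h0
    have hr := congrArg Complex.re h0
    have hi := congrArg Complex.im h0
    simp at hr hi
    rw [hr, hi] at hNpos
    norm_num at hNpos
  · rw [signOuter_apply, hN, hyi, hyi, hsq]
    simp only [Complex.add_re, Complex.add_im, Complex.ofReal_re, Complex.ofReal_im,
      Complex.re_ofReal_mul, Complex.im_ofReal_mul, Complex.I_re, Complex.I_im, mul_zero, mul_one,
      add_zero, zero_add]
    field_simp
    ring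

/-- With `s = √a` and `t = √b`, the numerator is `s t (s - t) ^ 2 / 2`, and `(s - t) ^ 2` cancels
against `(a - b) ^ 2`. The right side is therefore also correct on the diagonal. -/
lemma covFactor_eq {a b : ℝ} (ha : 0 < a) (hb : 0 < b) :
    covFactor a b = (1 - ((√a - √b) / (√a + √b)) ^ 2) / 8 := by
  have hsa := Real.sqrt_pos.2 ha
  have hsb := Real.sqrt_pos.2 hb
  unfold covFactor
  split_ifs with h
  · subst h
    simp
  · have hs : √(a * b) = √a * √b := Real.sqrt_mul ha.le b
    rw [hs]
    have h1 : a - b ≠ 0 := sub_ne_zero.2 h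
    obtain ⟨s, hs⟩ : ∃ s, s = √a := ⟨_, rfl⟩
    obtain ⟨t, ht⟩ : ∃ t, t = √b := ⟨_, rfl⟩
    have ea : a = s ^ 2 := by rw [hs, Real.sq_sqrt ha.le]
    have eb : b = t ^ 2 := by rw [ht, Real.sq_sqrt hb.le]
    rw [← hs, ← ht, ea, eb]
    rw [ea, eb] at h1
    have hst : s + t ≠ 0 := by rw [hs, ht]; positivity
    field_simp
    ring

/-- `W₀` is the sum of the outer squares of `(1, 0, 0, -1)` and `(0, 1, 1, 0)`, which match the real
and imaginary parts of the squared direction. -/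
lemma kronecker_mul_W₀_apply (U : Matrix (Fin 2) (Fin 2) ℝ) (q r : Fin 2 × Fin 2) :
    ((U ⊗ₖ U) * W₀.submatrix (vecIndex rfl) (vecIndex rfl) * (U ⊗ₖ U)ᵀ) q r =
      (U q.2 0 * U q.1 0 - U q.2 1 * U q.1 1) * (U r.2 0 * U r.1 0 - U r.2 1 * U r.1 1) +
      (U q.2 0 * U q.1 1 + U q.2 1 * U q.1 0) * (U r.2 0 * U r.1 1 + U r.2 1 * U r.1 0) := by
  have v00 : vecIndex (p := 2) rfl (0, 0) = 0 := rfl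
  have v01 : vecIndex (p := 2) rfl (0, 1) = 1 := rfl
  have v10 : vecIndex (p := 2) rfl (1, 0) = 2 := rfl
  have v11 : vecIndex (p := 2) rfl (1, 1) = 3 := rfl
  simp only [Matrix.mul_apply, Fintype.sum_prod_type, Fin.sum_univ_two, Matrix.transpose_apply,
    Matrix.kroneckerMap_apply, Matrix.submatrix_apply, v00, v01, v10, v11]
  simp [W₀]
  ring

/-- The asymptotic covariance matrix of a planar elliptical distribution. -/
theorem IsElliptical.signCov_eq {F : Measure (EuclideanSpace ℝ (Fin 2))}
    [IsProbabilityMeasure F] {m : EuclideanSpace ℝ (Fin 2)} {V U : Matrix (Fin 2) (Fin 2) ℝ}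
    {lam : Fin 2 → ℝ} (h : IsElliptical F m V) (hF : ∀ᵐ x ∂F, x - m ≠ 0)
    (hU : U ∈ Matrix.orthogonalGroup (Fin 2) ℝ) (hV : V = U * Matrix.diagonal lam * Uᵀ) :
    signCov F m = covFactor (lam 0) (lam 1) •
      ((U ⊗ₖ U) * W₀.submatrix (vecIndex rfl) (vecIndex rfl) * (U ⊗ₖ U)ᵀ) := by
  have hpos := pos_of_posDef h.1 hU hV
  have h1 := h.integral_sqDirection_pow hU hV 1
  have h2 := h.integral_sqDirection_pow hU hV 2
  simp only [pow_one] at h1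
  have hnorm : ∀ᵐ x ∂F, ‖sqDirection (planarCoord U (x - m))‖ = 1 :=
    hF.mono fun x hx => norm_sqDirection (signOuter_eq_sqDirection hU hx 0 0).1
  ext q r
  rw [Matrix.smul_apply, kronecker_mul_W₀_apply, covFactor_eq (hpos 0) (hpos 1), smul_eq_mul]
  have hentry : ∀ q : Fin 2 × Fin 2, (fun x => vecE (signOuter (x - m)) q) =ᵐ[F] fun x =>
      (U q.2 0 * U q.1 0 + U q.2 1 * U q.1 1) / 2 + ((U q.2 0 * U q.1 0 - U q.2 1 * U q.1 1) / 2 *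
        (sqDirection (planarCoord U (x - m))).re + (U q.2 0 * U q.1 1 + U q.2 1 * U q.1 0) / 2 *
        (sqDirection (planarCoord U (x - m))).im) := fun q =>
    hF.mono fun x hx => (signOuter_eq_sqDirection hU hx q.2 q.1).2
  have hcov : signCov F m q r = cov[fun x => vecE (signOuter (x - m)) q,
      fun x => vecE (signOuter (x - m)) r; F] := rfl
  rw [hcov, covariance_congr_ae (hentry q) (hentry r), covariance_affine_unitCircle
    (measurable_sqDirection_planarCoord U m) hnorm h1 h2]
  ring

end Planar

end SSCM

end

theorem proposition2 {Ω : Type*} [MeasurableSpace Ω] (P : Measure Ω) [IsProbabilityMeasure P]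
    {p : ℕ} (hp : 2 ≤ p)
    (F : Measure (EuclideanSpace ℝ (Fin p))) [IsProbabilityMeasure F]
    (X : ℕ → Ω → EuclideanSpace ℝ (Fin p))
    (hX : ∀ i, HasLaw (X i) F P) (hindep : iIndepFun X P)
    (hF : ∫⁻ x, ‖x - SSCM.spatialMedian F‖ₑ⁻¹ ∂F < ∞)
    (T : ℕ → Ω → EuclideanSpace ℝ (Fin p))
    (hTmeas : ∀ n, AEMeasurable (T n) P)
    (hT : ∀ᵐ ω ∂P, Tendsto (fun n => T n ω) atTop (𝓝 (SSCM.spatialMedian F))) :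
    (∀ᵐ ω ∂P, Tendsto (fun n : ℕ => SSCM.empiricalSSCM (fun i : Fin n => X i ω) (T n ω)) atTop
        (𝓝 (SSCM.sscm F))) ∧
    ((∃ (ν : Measure ℝ) (_ : IsProbabilityMeasure ν),
        TendstoInDistribution (fun (n : ℕ) ω => √(n : ℝ) * ‖T n ω - SSCM.spatialMedian F‖)
          atTop id (fun _ => P) ν) →
      ∫⁻ x, ‖x - SSCM.spatialMedian F‖ₑ ^ (-(3 / 2) : ℝ) ∂F < ∞ →
      F.map (fun x => x - SSCM.spatialMedian F) = F.map (fun x => -(x - SSCM.spatialMedian F)) →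
      ∃ W : Matrix (Fin p × Fin p) (Fin p × Fin p) ℝ,
        W.PosSemidef ∧
        TendstoInDistribution
          (fun (n : ℕ) ω => √(n : ℝ) •
            SSCM.vecE (SSCM.empiricalSSCM (fun i : Fin n => X i ω) (T n ω) - SSCM.sscm F))
          atTop id (fun _ => P) (multivariateGaussian 0 W) ∧
        ∀ (hp2 : p = 2) (m : EuclideanSpace ℝ (Fin p)) (V U : Matrix (Fin p) (Fin p) ℝ)
          (lam : Fin p → ℝ),
          SSCM.IsElliptical F m V →
          U ∈ Matrix.orthogonalGroup (Fin p) ℝ →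
          V = U * Matrix.diagonal lam * Uᵀ →
          lam ⟨1, by omega⟩ ≤ lam ⟨0, by omega⟩ →
          W = SSCM.covFactor (lam ⟨0, by omega⟩) (lam ⟨1, by omega⟩) •
            ((U ⊗ₖ U) * SSCM.W₀.submatrix (SSCM.vecIndex hp2) (SSCM.vecIndex hp2) *
              (U ⊗ₖ U)ᵀ)) := by
  refine ⟨SSCM.tendsto_empiricalSSCM_of_tendsto hX hindep hF hT, ?_⟩
  rintro ⟨ν, hνp, hν⟩ hF' hsymm
  refine ⟨SSCM.signCov F (SSCM.spatialMedian F),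
    SSCM.posSemidef_covMatrix SSCM.memLp_vecE_signOuter,
    SSCM.tendstoInDistribution_empiricalSSCM hX hindep hF hTmeas hT hν hF' hsymm, ?_⟩
  rintro rfl m V U lam hell hU hV -
  -- Both points are centers of symmetry of `F`, so the median is identified without solving the
  -- minimization problem.
  have hm : SSCM.spatialMedian F = m :=
    SSCM.center_unique (SSCM.map_reflection_eq hsymm) hell.map_reflection_eq
  have hne := SSCM.ae_sub_ne_zero hF
  rw [hm] at hne ⊢
  exact hell.signCov_eq hne hU hV
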